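/- Let $\mathbb S=\mathbb R/\mathbb Z$ be the circle with its arc-length metric and Lebesgue measure $\mathfrak m$ ($\mathfrak m(\mathbb S)=1$). Let $(\Omega,\mathcal F,\eta)$ be a probability space and, for each $\omega_1\in\Omega$, let $T_{\omega_1}:\mathbb S\to\mathbb S$ be a $C^2$ map without critical points, such that $(\omega_1,x)\mapsto T_{\omega_1}x$ is measurable. Put $\lambda_{\omega_1}=\inf|T_{\omega_1}'|$ and $\Delta_{\omega_1}=\|T_{\omega_1}''/(T_{\omega_1}')^2\|_\infty$, and assume $$\int\lambda_{\omega_1}^{-2}\,d\eta(\omega_1)<1,\qquad \int\Delta_{\omega_1}^2\,d\eta(\omega_1)<\infty .$$ Let $\mathcal L_{\omega_1}g(x)=\sum_{y\in T_{\omega_1}^{-1}\{x\}}g(y)/|T_{\omega_1}'(y)|$ be the transfer operator of $T_{\omega_1}$ with respect to $\mathfrak m$. For $\alpha\in(0,1)$ let $C^\alpha$ be the set of functions on $\mathbb S$ that are Hölder continuous with exponent $\alpha$, and let $\|f\|_\alpha=|f|_\alpha+\|f\|_\infty$, where $|f|_\alpha$ is the Hölder constant of $f$. Then there exists a constant $\theta\in(0,1)$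 such that the following holds. Let $\alpha\in(0,1)$. For almost every $\omega=(\omega_i)_{i\ge1}\in\Omega^{\mathbb N}$ with respect to the product measure $\eta^{\mathbb N}$ there exists $C(\omega)>0$ (which may also depend on $\alpha$) such that $$\|\mathcal L_{\omega_n}\cdots\mathcal L_{\omega_1}(\psi^1-\psi^2)\|_{L^1(\mathfrak m)}\le C(\omega)\max(\|\psi^1\|_\alpha,\|\psi^2\|_\alpha)\,\theta^{\alpha n}$$ for all $n\ge0$ and all probability densities $\psi^1,\psi^2\in C^\alpha$, and moreover, for every probability measure $d\nu=\psi\,d\mathfrak m$ with $\psi\in C^\alpha$, $$\left|\int f\cdot g\circ T_{\omega_n}\circ\cdots\circ T_{\omega_1}\,d\nu-\int f\,d\nu\int g\circ T_{\omega_n}\circ\cdots\circ T_{\omega_1}\,d\nu\right|\le C(\omega)\,\|\psi\|_\alpha\|f\|_\alpha\|g\|_\infty\,\theta^{\alpha n}$$ for all $n\ge0$ and all complex-valued functions $f\in C^\alpha$ and $g\in L^\infty(\mathfrak m)$. -/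

import Mathlib

open MeasureTheory
open scoped NNReal ENNReal

noncomputable section

namespace RandomCircle

/-- `F : ℝ → ℝ` is a `C²` lift of the circle map `T` to the universal cover. -/
def IsC2Lift (T : UnitAddCircle → UnitAddCircle) (F : ℝ → ℝ) : Prop :=
  ContDiff ℝ 2 F ∧ ∀ t : ℝ, T (t : UnitAddCircle) = (F t : UnitAddCircle)

/-- `T` is a `C²` self-map of the circle `ℝ / ℤ`. -/
def IsC2 (T : UnitAddCircle → UnitAddCircle) : Prop := ∃ F, IsC2Lift T F

open Classical in
/-- A choice of a `C²` lift of a `C²` circle map. -/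
def lift (T : UnitAddCircle → UnitAddCircle) : ℝ → ℝ :=
  if h : IsC2 T then h.choose else 0

/-- The representative in `[0, 1)` of a point of the circle. -/
def rep (x : UnitAddCircle) : ℝ := (AddCircle.equivIco 1 0 x : ℝ)

/-- The derivative `T'` of a `C²` circle map; see `circleDeriv_coe` below. -/
def circleDeriv (T : UnitAddCircle → UnitAddCircle) (x : UnitAddCircle) : ℝ :=
  deriv (lift T) (rep x)

/-- The second derivative `T''` of a `C²` circle map; see `circleDeriv2_coe` below. -/
def circleDeriv2 (T : UnitAddCircle → UnitAddCircle) (x : UnitAddCircle) : ℝ :=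
  deriv (deriv (lift T)) (rep x)

/-- The dilation `λ = inf |T'|`. -/
def dilation (T : UnitAddCircle → UnitAddCircle) : ℝ :=
  ⨅ x : UnitAddCircle, |circleDeriv T x|

/-- The distortion `Δ = ‖T'' / (T')²‖_∞`. -/
def distortion (T : UnitAddCircle → UnitAddCircle) : ℝ :=
  ⨆ x : UnitAddCircle, |circleDeriv2 T x / circleDeriv T x ^ 2|

/-- The transfer operator of `T` with respect to Lebesgue measure. The sum over the preimages is
finite when `T` is `C²` without critical points. -/
def transfer (T : UnitAddCircle → UnitAddCircle) (g : UnitAddCircle → ℝ) (x : UnitAddCircle) : ℝ :=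
  ∑ᶠ y ∈ T ⁻¹' {x}, g y / |circleDeriv T y|

/-- The composition `T_{ω_n} ∘ ⋯ ∘ T_{ω_1}`, where `ω_{i+1}` is written `ω i`. -/
def comp {Ω : Type*} (T : Ω → UnitAddCircle → UnitAddCircle) (ω : ℕ → Ω) :
    ℕ → UnitAddCircle → UnitAddCircle
  | 0 => id
  | n + 1 => T (ω n) ∘ comp T ω n

/-- The product `𝓛_{ω_n} ⋯ 𝓛_{ω_1}` of transfer operators, where `ω_{i+1}` is written `ω i`. -/
def transferComp {Ω : Type*} (T : Ω → UnitAddCircle → UnitAddCircle) (ω : ℕ → Ω) :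
    ℕ → (UnitAddCircle → ℝ) → UnitAddCircle → ℝ
  | 0, g => g
  | n + 1, g => transfer (T (ω n)) (transferComp T ω n g)

/-- The Hölder norm `‖f‖_α = |f|_α + ‖f‖_∞`. -/
def holderNorm {E : Type*} [NormedAddCommGroup E] (α : ℝ≥0) (f : UnitAddCircle → E) : ℝ :=
  (nnHolderNorm α f : ℝ) + ⨆ x : UnitAddCircle, ‖f x‖

/-- `ψ` is a probability density, with respect to Lebesgue measure, of class `C^α`. -/
structure IsHolderDensity (α : ℝ≥0) (ψ : UnitAddCircle → ℝ) : Prop where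
  memHolder : MemHolder α ψ
  nonneg : ∀ x, 0 ≤ ψ x
  integral_eq_one : ∫ x, ψ x = 1

/-- The measure `dν = ψ d𝔪`. -/
def densityMeasure (ψ : UnitAddCircle → ℝ) : Measure UnitAddCircle :=
  volume.withDensity fun x => ENNReal.ofReal (ψ x)

/-! The derivatives do not depend on the lift, nor on the representative of the point. -/

theorem eq_add_int_of_coe_eq {F G : ℝ → ℝ} (hF : Continuous F) (hG : Continuous G)
    (h : ∀ t, (F t : UnitAddCircle) = (G t : UnitAddCircle)) :
    ∃ n : ℤ, ∀ t, F t = G t + n := by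
  have h1 : ∀ t, ∃ n : ℤ, (n : ℝ) = F t - G t := by
    intro t
    have h2 : ((F t - G t : ℝ) : UnitAddCircle) = 0 := by
      rw [AddCircle.coe_sub, h t, sub_self]
    obtain ⟨n, hn⟩ := (AddCircle.coe_eq_zero_iff (1 : ℝ)).1 h2
    exact ⟨n, by simpa using hn⟩
  choose n hn using h1
  have hc : Continuous n := by
    rw [Int.isClosedEmbedding_coe_real.isEmbedding.continuous_iff]
    exact (hF.sub hG).congr fun t => (hn t).symm
  refine ⟨n 0, fun t => ?_⟩
  have := PreconnectedSpace.constant (Y := ℤ) inferInstance hc (x := t) (y := 0)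
  rw [← this, hn t]; ring

theorem lift_spec {T : UnitAddCircle → UnitAddCircle} (hT : IsC2 T) : IsC2Lift T (lift T) := by
  rw [lift, dif_pos hT]; exact hT.choose_spec

theorem lift_eq {T : UnitAddCircle → UnitAddCircle} {F : ℝ → ℝ} (hF : IsC2Lift T F) (t : ℝ) :
    ∃ n m : ℤ, ∀ s, lift T s = F (s + n) + m ∧ rep (t : UnitAddCircle) + n = t := by
  have hL := lift_spec ⟨F, hF⟩
  have h0 : ((t - rep (t : UnitAddCircle) : ℝ) : UnitAddCircle) = 0 := by
    rw [AddCircle.coe_sub, rep, AddCircle.coe_equivIco, sub_self]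
  obtain ⟨n, hn⟩ := (AddCircle.coe_eq_zero_iff (1 : ℝ)).1 h0
  have hn' : (n : ℝ) = t - rep (t : UnitAddCircle) := by simpa using hn
  obtain ⟨m, hm⟩ := eq_add_int_of_coe_eq (F := lift T) (G := fun s => F (s + n))
    hL.1.continuous (hF.1.continuous.comp (continuous_id.add continuous_const)) (by
      intro s
      rw [← hL.2, ← hF.2]
      congr 1
      rw [AddCircle.coe_add]
      have : ((n : ℝ) : UnitAddCircle) = 0 :=
        (AddCircle.coe_eq_zero_iff (1 : ℝ)).2 ⟨n, by simp⟩
      rw [this, add_zero])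
  exact ⟨n, m, fun s => ⟨hm s, by rw [hn']; ring⟩⟩

theorem circleDeriv_coe {T : UnitAddCircle → UnitAddCircle} {F : ℝ → ℝ} (hF : IsC2Lift T F)
    (t : ℝ) : circleDeriv T (t : UnitAddCircle) = deriv F t := by
  obtain ⟨n, m, h⟩ := lift_eq hF t
  have h1 : lift T = fun s => F (s + n) + m := funext fun s => (h s).1
  rw [circleDeriv, h1, deriv_add_const, deriv_comp_add_const, (h 0).2]

theorem circleDeriv2_coe {T : UnitAddCircle → UnitAddCircle} {F : ℝ → ℝ} (hF : IsC2Lift T F)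
    (t : ℝ) : circleDeriv2 T (t : UnitAddCircle) = deriv (deriv F) t := by
  obtain ⟨n, m, h⟩ := lift_eq hF t
  have h1 : deriv (lift T) = fun s => deriv F (s + n) := by
    funext s
    rw [show lift T = fun s => F (s + n) + m from funext fun s => (h s).1, deriv_add_const,
      deriv_comp_add_const]
  rw [circleDeriv2, h1, deriv_comp_add_const, (h 0).2]

end RandomCircle

end

/-! The argument is a coupling by splitting off constants. On the universal cover each map is a
diffeomorphism whose inverse has derivative at most `(dilation T)⁻¹`, with logarithmic distortion
controlled by `distortion T`. Hence a transfer operator turns a nonnegative function with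
`K`-Lipschitz logarithm into one with constant `λ⁻¹ K + Δ`
(`IsInverseLift.isLogLipschitz_transfer`). Such a function of mass `m` is at least `e^{-K} m`, so
the same constant `κ e^{-K} m` can be removed from two densities of equal mass. Their difference is
unchanged, the mass shrinks by `1 - κ e^{-K}`, and the logarithmic constant grows only by `1 + δ`,
where `(1 - κ)(1 + δ) = 1` (`IsRegular.sub_const`). The `L¹` norm of the iterated difference is
therefore at most twice the remaining mass.

The constants follow the random affine recursion `K ↦ (1 + δ) λ⁻¹ K + Δ`. Since `λ⁻¹` has mean below
1, a small `δ` keeps it contracting on average. The mass factor at a step depends only on earlier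
maps, so the next map is independent of it, and a Lyapunov estimate (`exists_drift`) makes the mean
of `M (1 + ε K)`, with `M` the remaining mass, decay geometrically. Summing over time gives almost
sure decay at a rate `θ` depending only on the law of the maps (`ae_exists_remMass_le`).

A Hölder function is approximated by a Lipschitz one at scale `θ ^ n`, which turns `θ ^ n` into `θ ^
(α n)`. Correlations reduce, by duality, to the mean zero Hölder function `ψ (f - ∫ f dν)`. -/

namespace RandomCircle

/-! ### The inverse of a lift -/

/-- `F` is a `C²` lift of `T` of degree `d` without critical points, and `G` is its inverse. -/
structure IsInverseLift (T : UnitAddCircle → UnitAddCircle) (F G : ℝ → ℝ) (d : ℤ) : Prop where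
  isC2Lift : IsC2Lift T F
  map_add_one : ∀ t, F (t + 1) = F t + d
  degree_ne_zero : d ≠ 0
  right_inv : ∀ t, F (G t) = t
  left_inv : ∀ s, G (F s) = s
  deriv_ne_zero : ∀ s, deriv F s ≠ 0
  hasDerivAt : ∀ t, HasDerivAt G (deriv F (G t))⁻¹ t

theorem coe_add_int (t : ℝ) (n : ℤ) : ((t + n : ℝ) : UnitAddCircle) = t := by
  have : ((n : ℝ) : UnitAddCircle) = 0 := (AddCircle.coe_eq_zero_iff (1 : ℝ)).2 ⟨n, by simp⟩
  rw [AddCircle.coe_add, this, add_zero]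

theorem coe_eq_coe_iff {s t : ℝ} :
    (s : UnitAddCircle) = (t : UnitAddCircle) ↔ ∃ n : ℤ, s = t + n := by
  constructor
  · intro h
    have h2 : ((s - t : ℝ) : UnitAddCircle) = 0 := by rw [AddCircle.coe_sub, h, sub_self]
    obtain ⟨n, hn⟩ := (AddCircle.coe_eq_zero_iff (1 : ℝ)).1 h2
    refine ⟨n, ?_⟩
    have hn' : (n : ℝ) = s - t := by simpa using hn
    rw [hn']; ring
  · rintro ⟨n, rfl⟩
    exact coe_add_int t n

theorem map_add_int {F : ℝ → ℝ} {d : ℤ} (h : ∀ t, F (t + 1) = F t + d) (t : ℝ) (n : ℤ) :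
    F (t + n) = F t + n * d := by
  induction n using Int.induction_on with
  | zero => simp
  | succ k ih =>
    push_cast at ih ⊢
    rw [← add_assoc, h, ih]; ring
  | pred k ih =>
    have h1 := h (t + ((-(k : ℤ) - 1 : ℤ) : ℝ))
    push_cast at ih h1 ⊢
    rw [show t + (-(k : ℝ) - 1) + 1 = t + -k by ring, ih] at h1
    linarith

theorem exists_isInverseLift {T : UnitAddCircle → UnitAddCircle} (hT : IsC2 T)
    (hcrit : ∀ x, circleDeriv T x ≠ 0) : ∃ F G d, IsInverseLift T F G d := by
  obtain ⟨F, hF⟩ := hT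
  have hFc : Continuous F := hF.1.continuous
  have hF' : ∀ s, deriv F s ≠ 0 := fun s => by
    rw [← circleDeriv_coe hF]; exact hcrit _
  have hinj : Function.Injective F := by
    have key : ∀ a b, a < b → F a ≠ F b := fun a b hab h => by
      obtain ⟨c, -, hc⟩ := exists_deriv_eq_zero hab hFc.continuousOn h
      exact hF' c hc
    intro a b h
    rcases lt_trichotomy a b with h1 | h1 | h1
    · exact (key a b h1 h).elim
    · exact h1
    · exact (key b a h1 h.symm).elim
  obtain ⟨d, hd⟩ := eq_add_int_of_coe_eq (F := fun t => F (t + 1)) (G := F)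
    (hFc.comp (continuous_id.add continuous_const)) hFc (fun t => by
      have h := coe_add_int t 1
      rw [Int.cast_one] at h
      rw [← hF.2, ← hF.2, h])
  have hd0 : d ≠ 0 := by
    rintro rfl
    have := hinj (a₁ := 0 + 1) (a₂ := 0) ((hd 0).trans (by simp))
    norm_num at this
  have hd2 : (1 : ℝ) ≤ (d : ℝ) * d := by
    have : (1 : ℤ) ≤ d * d := by
      have := mul_self_pos.2 hd0
      omega
    exact_mod_cast this
  have hsurj : Function.Surjective F := fun y => by
    refine mem_range_of_exists_le_of_exists_ge hFc ?_ ?_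
    · obtain ⟨k, hk⟩ := exists_nat_ge (F 0 - y)
      -- Shifting the argument by a multiple of `d` moves the value by that multiple of `d²`, so the
      -- sign of the degree does not matter.
      refine ⟨0 + ((-(k : ℤ) * d : ℤ) : ℝ), ?_⟩
      rw [map_add_int hd]
      push_cast
      nlinarith [(Nat.cast_nonneg k : (0 : ℝ) ≤ k)]
    · obtain ⟨k, hk⟩ := exists_nat_ge (y - F 0)
      refine ⟨0 + (((k : ℤ) * d : ℤ) : ℝ), ?_⟩
      rw [map_add_int hd]
      push_cast
      nlinarith [(Nat.cast_nonneg k : (0 : ℝ) ≤ k)]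
  have hstrict : ∀ s, HasStrictDerivAt F (deriv F s) s := fun s =>
    (hF.1.contDiffAt.hasStrictDerivAt (by norm_num))
  let e := (Equiv.ofBijective F ⟨hinj, hsurj⟩).toHomeomorphOfContinuousOpen hFc
    (isOpenMap_of_hasStrictDerivAt hstrict hF')
  have hr : ∀ t, F (e.symm t) = t := fun t => e.apply_symm_apply t
  refine ⟨F, e.symm, d, hF, hd, hd0, hr, fun s => e.symm_apply_apply s, hF', fun t => ?_⟩
  exact HasDerivAt.of_local_left_inverse e.symm.continuous.continuousAt
    (hstrict _).hasDerivAt (hF' _) (Filter.Eventually.of_forall hr)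

namespace IsInverseLift

variable {T : UnitAddCircle → UnitAddCircle} {F G : ℝ → ℝ} {d : ℤ}

theorem apply_coe (h : IsInverseLift T F G d) (t : ℝ) :
    T (G t : UnitAddCircle) = (t : UnitAddCircle) := by
  rw [h.isC2Lift.2, h.right_inv]

theorem continuous_inv (h : IsInverseLift T F G d) : Continuous G :=
  continuous_iff_continuousAt.2 fun t => (h.hasDerivAt t).continuousAt

theorem continuous_deriv (h : IsInverseLift T F G d) : Continuous (deriv F) :=
  h.isC2Lift.1.continuous_deriv (by norm_num)

theorem continuous_weight (h : IsInverseLift T F G d) :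
    Continuous fun t => |deriv F (G t)|⁻¹ :=
  (h.continuous_deriv.comp h.continuous_inv).abs.inv₀ fun _ => abs_ne_zero.2 (h.deriv_ne_zero _)

/-- The points `G (t + k)` and `G (t + j)` agree on the circle exactly when `k ≡ j` modulo `d`,
since an integer shift before `F` becomes a multiple of `d` after it. This labels the inverse
branches. -/
theorem bijOn_preimage (h : IsInverseLift T F G d) (t : ℝ) :
    Set.BijOn (fun k : ℕ => (G (t + k) : UnitAddCircle)) (Finset.range d.natAbs)
      (T ⁻¹' {(t : UnitAddCircle)}) := by
  refine ⟨fun k _ => ?_, fun k hk j hj hkj => ?_, fun y hy => ?_⟩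
  · rw [Set.mem_preimage, Set.mem_singleton_iff, h.apply_coe]
    exact_mod_cast coe_add_int t k
  · obtain ⟨n, hn⟩ := coe_eq_coe_iff.1 hkj
    have h1 := congrArg F hn
    rw [map_add_int h.map_add_one, h.right_inv, h.right_inv] at h1
    have h2 : (k : ℤ) = j + n * d := by
      have : (k : ℝ) = j + n * d := by linarith
      exact_mod_cast this
    simp only [Finset.coe_range, Set.mem_Iio] at hk hj
    have h3 : (k : ℤ) % d = j % d := by rw [h2, Int.add_mul_emod_self_right]
    rw [← Int.emod_abs, ← Int.emod_abs (j : ℤ), ← Int.natCast_natAbs, Int.emod_eq_of_lt (by omega)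
      (by omega), Int.emod_eq_of_lt (by omega) (by omega)] at h3
    exact_mod_cast h3
  · obtain ⟨s, rfl⟩ := QuotientAddGroup.mk_surjective y
    have h1 : ((F s : ℝ) : UnitAddCircle) = t := by
      rw [← h.isC2Lift.2]; exact hy
    obtain ⟨m, hm⟩ := coe_eq_coe_iff.1 h1
    have hpos : 0 ≤ m % d := Int.emod_nonneg _ h.degree_ne_zero
    have hlt : m % d < d.natAbs := by
      rw [Int.natCast_natAbs]; exact Int.emod_lt_abs m h.degree_ne_zero
    refine ⟨(m % d).toNat, ?_, ?_⟩
    · simp only [Finset.coe_range, Set.mem_Iio]; omega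
    · have h2 : (((m % d).toNat : ℕ) : ℝ) = ((m % d : ℤ) : ℝ) := by
        exact_mod_cast congrArg (Int.cast : ℤ → ℝ) (Int.toNat_of_nonneg hpos)
      have h3 : F (s + ((-(m / d) : ℤ) : ℝ)) = t + ((m % d).toNat : ℕ) := by
        rw [map_add_int h.map_add_one, hm, h2]
        have : ((m % d : ℤ) : ℝ) = m - d * (m / d : ℤ) := by
          exact_mod_cast congrArg (Int.cast : ℤ → ℝ) (Int.emod_def m d)
        rw [this]; push_cast; ring
      change ((G _ : ℝ) : UnitAddCircle) = _
      rw [← h3, h.left_inv, coe_add_int]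

theorem transfer_coe (h : IsInverseLift T F G d) (u : UnitAddCircle → ℝ) (t : ℝ) :
    transfer T u (t : UnitAddCircle) =
      ∑ k ∈ Finset.range d.natAbs, u (G (t + k) : ℝ) * |deriv F (G (t + k))|⁻¹ := by
  rw [transfer, ← finsum_mem_coe_finset]
  symm
  refine finsum_mem_eq_of_bijOn _ (h.bijOn_preimage t) fun k _ => ?_
  rw [circleDeriv_coe h.isC2Lift, div_eq_mul_inv]

/-- The two cases are the two orientations: an increasing `G` keeps the closed end on the right, a
decreasing one moves it to the left. Either way the image is a fundamental domain. -/
theorem image_Ioc (h : IsInverseLift T F G d) :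
    (∃ a, G '' Set.Ioc 0 (d.natAbs : ℝ) = Set.Ioc a (a + 1)) ∨
      ∃ a, G '' Set.Ioc 0 (d.natAbs : ℝ) = Set.Ico a (a + 1) := by
  have himg : G '' Set.Ioc 0 (d.natAbs : ℝ) = F ⁻¹' Set.Ioc 0 (d.natAbs : ℝ) :=
    congrFun (Set.image_eq_preimage_of_inverse h.right_inv h.left_inv) _
  have hinj : Function.Injective F := (Function.LeftInverse.injective h.left_inv)
  have hd := h.degree_ne_zero
  rcases h.isC2Lift.1.continuous.strictMono_of_inj hinj with hm | hm
  · left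
    refine ⟨G 0, ?_⟩
    have h1 : F (G 0 + 1) = (d.natAbs : ℝ) := by
      have h2 : F (G 0 + 1) = d := by rw [h.map_add_one, h.right_inv, zero_add]
      have h3 : (0 : ℝ) < d := by
        have := hm (lt_add_one (G 0)); rwa [h2, h.right_inv] at this
      rw [h2, Nat.cast_natAbs, abs_of_pos (by exact_mod_cast h3)]
    rw [himg]
    ext s
    rw [Set.mem_preimage, Set.mem_Ioc, Set.mem_Ioc, ← h1, hm.le_iff_le, ← hm.lt_iff_lt (a := G 0),
      h.right_inv]
  · right
    refine ⟨G 0 - 1, ?_⟩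
    have h1 : F (G 0 - 1) = (d.natAbs : ℝ) := by
      have h2 : F (G 0 - 1) = -d := by
        have := h.map_add_one (G 0 - 1)
        rw [sub_add_cancel, h.right_inv] at this
        linarith
      have h3 : (d : ℝ) < 0 := by
        have := hm (sub_one_lt (G 0)); rw [h2, h.right_inv] at this
        linarith
      rw [h2, Nat.cast_natAbs, abs_of_neg (by exact_mod_cast h3)]
      push_cast; rfl
    rw [himg]
    ext s
    rw [Set.mem_preimage, Set.mem_Ioc, Set.mem_Ico, ← h1, hm.le_iff_ge, sub_add_cancel,
      ← hm.lt_iff_gt (a := G 0), h.right_inv, and_comm]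

end IsInverseLift

/-! ### Duality -/

section Duality

variable {E : Type*} [NormedAddCommGroup E]

theorem intervalIntegrable_coe {g : UnitAddCircle → E} (hg : Integrable g) (a b : ℝ) :
    IntervalIntegrable (fun t : ℝ => g t) volume a b := by
  have hper : Function.Periodic (fun t : ℝ => g t) 1 := fun t => by
    have h := coe_add_int t 1
    rw [Int.cast_one] at h
    simp only [h]
  refine hper.intervalIntegrable (t := 0) one_ne_zero ?_ a b
  rw [intervalIntegrable_iff_integrableOn_Ioc_of_le (by norm_num)]
  exact (UnitAddCircle.measurePreserving_mk 0).integrable_comp_of_integrable hg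

theorem integrable_of_integrableOn_coe {g : UnitAddCircle → E} {a : ℝ}
    (hg : IntegrableOn (fun t : ℝ => g t) (Set.Ioc a (a + 1))) : Integrable g := by
  have h1 := (AddCircle.measurePreserving_equivIoc (T := 1) (a := a)).integrable_comp_of_integrable
    ((integrableOn_iff_comap_subtypeVal measurableSet_Ioc).1 hg)
  refine h1.congr (Filter.Eventually.of_forall fun x => ?_)
  exact congrArg g AddCircle.coe_equivIoc

variable {T : UnitAddCircle → UnitAddCircle} {F G : ℝ → ℝ} {d : ℤ}

theorem IsInverseLift.integrableOn_image (h : IsInverseLift T F G d) {φ : UnitAddCircle → E} :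
    IntegrableOn (fun s : ℝ => φ s) (G '' Set.Ioc 0 (d.natAbs : ℝ)) → Integrable φ := by
  rcases h.image_Ioc with ⟨a, ha⟩ | ⟨a, ha⟩ <;> rw [ha]
  · exact integrable_of_integrableOn_coe
  · rw [integrableOn_Ico_iff_integrableOn_Ioo, ← integrableOn_Ioc_iff_integrableOn_Ioo]
    exact integrable_of_integrableOn_coe

variable [NormedSpace ℝ E]

theorem IsInverseLift.setIntegral_image (h : IsInverseLift T F G d) (φ : UnitAddCircle → E) :
    ∫ s in G '' Set.Ioc 0 (d.natAbs : ℝ), φ (s : ℝ) = ∫ x, φ x := by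
  rcases h.image_Ioc with ⟨a, ha⟩ | ⟨a, ha⟩ <;> rw [ha]
  · exact UnitAddCircle.integral_preimage a φ
  · rw [integral_Ico_eq_integral_Ioo, ← integral_Ioc_eq_integral_Ioo]
    exact UnitAddCircle.integral_preimage a φ

theorem IsInverseLift.injective_inv (h : IsInverseLift T F G d) : Function.Injective G :=
  Function.LeftInverse.injective h.right_inv

theorem IsInverseLift.integrable_comp (h : IsInverseLift T F G d) {g : UnitAddCircle → E}
    (hg : Integrable g) : Integrable fun x => g (T x) := by
  apply h.integrableOn_image
  rw [integrableOn_image_iff_integrableOn_abs_deriv_smul measurableSet_Ioc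
    (fun t _ => (h.hasDerivAt t).hasDerivWithinAt) h.injective_inv.injOn,
    ← intervalIntegrable_iff_integrableOn_Ioc_of_le (Nat.cast_nonneg _)]
  simp only [h.apply_coe, abs_inv]
  exact (intervalIntegrable_coe hg _ _).continuousOn_smul h.continuous_weight.continuousOn

/-- Substituting `s = G t` turns a fundamental domain into an interval of length `|d|`; cutting it
into unit pieces and using periodicity of `g` produces the sum over inverse branches. -/
theorem IsInverseLift.integral_smul_comp (h : IsInverseLift T F G d) {u : UnitAddCircle → ℝ}
    (hu : Continuous u) {g : UnitAddCircle → E} (hg : Integrable g) :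
    ∫ x, u x • g (T x) = ∫ x, transfer T u x • g x := by
  set Φ : ℝ → E := fun t => (u (G t : ℝ) * |deriv F (G t)|⁻¹) • g (t : UnitAddCircle) with hΦ
  have hint : ∀ a b, IntervalIntegrable Φ volume a b := fun a b =>
    (intervalIntegrable_coe hg a b).continuousOn_smul
      (((hu.comp (AddCircle.continuous_mk' 1)).comp h.continuous_inv).mul
        h.continuous_weight).continuousOn
  have hshift : ∀ (t : ℝ) (k : ℕ), ((t + k : ℝ) : UnitAddCircle) = t := fun t k => by
    exact_mod_cast coe_add_int t k
  calc ∫ x, u x • g (T x)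
      = ∫ s in G '' Set.Ioc 0 (d.natAbs : ℝ), u (s : ℝ) • g (T (s : ℝ)) :=
        (h.setIntegral_image fun x => u x • g (T x)).symm
    _ = ∫ t in Set.Ioc 0 (d.natAbs : ℝ), Φ t := by
        rw [integral_image_eq_integral_abs_deriv_smul measurableSet_Ioc
          (fun t _ => (h.hasDerivAt t).hasDerivWithinAt) h.injective_inv.injOn]
        simp only [h.apply_coe, abs_inv, smul_smul, hΦ, mul_comm]
    _ = ∫ t in ((0 : ℕ) : ℝ)..(d.natAbs : ℝ), Φ t := by
        rw [Nat.cast_zero, intervalIntegral.integral_of_le (Nat.cast_nonneg _)]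
    _ = ∑ k ∈ Finset.range d.natAbs, ∫ t in (k : ℝ)..((k + 1 : ℕ) : ℝ), Φ t :=
        (intervalIntegral.sum_integral_adjacent_intervals fun k _ => hint _ _).symm
    _ = ∑ k ∈ Finset.range d.natAbs, ∫ t in (0 : ℝ)..1, Φ (t + k) := by
        refine Finset.sum_congr rfl fun k _ => ?_
        rw [intervalIntegral.integral_comp_add_right, zero_add, Nat.cast_add, Nat.cast_one,
          add_comm (k : ℝ)]
    _ = ∫ t in (0 : ℝ)..1, ∑ k ∈ Finset.range d.natAbs, Φ (t + k) := by
        refine (intervalIntegral.integral_finsetSum fun k _ => ?_).symm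
        have := (hint (0 + k) (1 + k)).comp_add_right (k : ℝ)
        simpa using this
    _ = ∫ t in (0 : ℝ)..0 + 1, transfer T u (t : UnitAddCircle) • g (t : UnitAddCircle) := by
        rw [zero_add]
        refine intervalIntegral.integral_congr fun t _ => ?_
        simp only [hΦ, hshift, h.transfer_coe, Finset.sum_smul]
    _ = ∫ x, transfer T u x • g x :=
        UnitAddCircle.intervalIntegral_preimage 0 fun x => transfer T u x • g x

end Duality

/-! ### The transfer operator on continuous functions -/

section Transfer

variable {T : UnitAddCircle → UnitAddCircle} {F G : ℝ → ℝ} {d : ℤ}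

theorem integrable_of_continuous {E : Type*} [NormedAddCommGroup E] {u : UnitAddCircle → E}
    (hu : Continuous u) : Integrable u :=
  hu.integrable_of_hasCompactSupport (HasCompactSupport.of_compactSpace u)

theorem IsInverseLift.continuous_transfer (h : IsInverseLift T F G d) {u : UnitAddCircle → ℝ}
    (hu : Continuous u) : Continuous (transfer T u) := by
  refine (QuotientAddGroup.isQuotientMap_mk
    (N := AddSubgroup.zmultiples (1 : ℝ))).continuous_iff.2 ?_
  have : (transfer T u ∘ (QuotientAddGroup.mk : ℝ → UnitAddCircle)) = fun t : ℝ =>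
      ∑ k ∈ Finset.range d.natAbs, u (G (t + k) : ℝ) * |deriv F (G (t + k))|⁻¹ :=
    funext fun t => h.transfer_coe u t
  rw [this]
  refine continuous_finsetSum _ fun k _ => ?_
  have hk : Continuous fun t : ℝ => t + k := continuous_id.add continuous_const
  exact (((hu.comp (AddCircle.continuous_mk' 1)).comp h.continuous_inv).mul
    h.continuous_weight).comp hk

theorem IsInverseLift.integral_transfer (h : IsInverseLift T F G d) {u : UnitAddCircle → ℝ}
    (hu : Continuous u) : ∫ x, transfer T u x = ∫ x, u x := by
  have := h.integral_smul_comp hu (g := fun _ => (1 : ℝ)) (integrable_const _)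
  simpa using this.symm

theorem IsInverseLift.transfer_add (h : IsInverseLift T F G d) (u v : UnitAddCircle → ℝ) :
    transfer T (u + v) = transfer T u + transfer T v := by
  funext x
  obtain ⟨t, rfl⟩ := QuotientAddGroup.mk_surjective x
  change transfer T (u + v) (t : UnitAddCircle) =
    transfer T u (t : UnitAddCircle) + transfer T v (t : UnitAddCircle)
  rw [h.transfer_coe, h.transfer_coe, h.transfer_coe]
  simp only [Pi.add_apply, add_mul, Finset.sum_add_distrib]

theorem IsInverseLift.transfer_smul (h : IsInverseLift T F G d) (c : ℝ) (u : UnitAddCircle → ℝ) :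
    transfer T (c • u) = c • transfer T u := by
  funext x
  obtain ⟨t, rfl⟩ := QuotientAddGroup.mk_surjective x
  change transfer T (c • u) (t : UnitAddCircle) = c • transfer T u (t : UnitAddCircle)
  rw [h.transfer_coe, h.transfer_coe]
  simp only [Pi.smul_apply, smul_eq_mul, Finset.mul_sum, mul_assoc]

theorem transfer_nonneg {u : UnitAddCircle → ℝ} (hu : ∀ x, 0 ≤ u x) (x : UnitAddCircle) :
    0 ≤ transfer T u x :=
  finsum_mem_induction (fun r : ℝ => 0 ≤ r) le_rfl (fun _ _ => add_nonneg) fun y _ =>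
    div_nonneg (hu y) (abs_nonneg _)

theorem IsInverseLift.abs_transfer_le (h : IsInverseLift T F G d) (u : UnitAddCircle → ℝ)
    (x : UnitAddCircle) : |transfer T u x| ≤ transfer T (fun y => |u y|) x := by
  obtain ⟨t, rfl⟩ := QuotientAddGroup.mk_surjective x
  rw [h.transfer_coe, h.transfer_coe]
  refine (Finset.abs_sum_le_sum_abs _ _).trans_eq (Finset.sum_congr rfl fun k _ => ?_)
  rw [abs_mul, abs_inv, abs_abs]

theorem IsInverseLift.integral_abs_transfer_le (h : IsInverseLift T F G d) {u : UnitAddCircle → ℝ}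
    (hu : Continuous u) : ∫ x, |transfer T u x| ≤ ∫ x, |u x| := by
  rw [← h.integral_transfer hu.abs]
  exact integral_mono (integrable_of_continuous (h.continuous_transfer hu).abs)
    (integrable_of_continuous (h.continuous_transfer hu.abs)) (h.abs_transfer_le u)

end Transfer

/-! ### Logarithmic regularity -/

section LogLipschitz

variable {T : UnitAddCircle → UnitAddCircle} {F G : ℝ → ℝ} {d : ℤ}

/-- For positive `f`, this says that the lift of `log f` to `ℝ` is `K`-Lipschitz. -/
def IsLogLipschitz (K : ℝ) (f : UnitAddCircle → ℝ) : Prop :=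
  ∀ s t : ℝ, f s ≤ Real.exp (K * |s - t|) * f t

/-- Lets compactness of `[0, 1]` bound the infimum and the supremum over the circle. -/
theorem IsInverseLift.exists_Icc (h : IsInverseLift T F G d) (x : UnitAddCircle) :
    ∃ s ∈ Set.Icc (0 : ℝ) 1, circleDeriv T x = deriv F s ∧
      circleDeriv2 T x = deriv (deriv F) s := by
  refine ⟨rep x, ?_, ?_⟩
  · have h1 := (AddCircle.equivIco 1 0 x).2
    exact ⟨h1.1, h1.2.le.trans_eq (zero_add 1)⟩
  · have hx : ((rep x : ℝ) : UnitAddCircle) = x := AddCircle.coe_equivIco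
    rw [← circleDeriv_coe h.isC2Lift, ← circleDeriv2_coe h.isC2Lift, hx]
    exact ⟨rfl, rfl⟩

theorem IsInverseLift.dilation_pos (h : IsInverseLift T F G d) : 0 < dilation T := by
  obtain ⟨s₀, -, hs₀⟩ := isCompact_Icc.exists_isMinOn (Set.nonempty_Icc.2 (zero_le_one' ℝ))
    h.continuous_deriv.abs.continuousOn
  refine lt_of_lt_of_le (abs_pos.2 (h.deriv_ne_zero s₀)) (le_ciInf fun x => ?_)
  obtain ⟨s, hs, hx, -⟩ := h.exists_Icc x
  rw [hx]
  exact hs₀ hs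

theorem IsInverseLift.dilation_le (h : IsInverseLift T F G d) (s : ℝ) :
    dilation T ≤ |deriv F s| := by
  rw [← circleDeriv_coe h.isC2Lift]
  exact ciInf_le ⟨0, by rintro _ ⟨x, rfl⟩; exact abs_nonneg _⟩ _

theorem distortion_nonneg : 0 ≤ distortion T := Real.iSup_nonneg fun _ => abs_nonneg _

theorem IsInverseLift.le_distortion (h : IsInverseLift T F G d) (s : ℝ) :
    |deriv (deriv F) s / deriv F s ^ 2| ≤ distortion T := by
  rw [← circleDeriv_coe h.isC2Lift, ← circleDeriv2_coe h.isC2Lift]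
  have hc2 : Continuous (deriv (deriv F)) := by
    have h1 : ContDiff ℝ 1 (deriv F) :=
      ((contDiff_succ_iff_deriv (n := 1)).1 (by simpa [one_add_one_eq_two] using h.isC2Lift.1)).2.2
    exact h1.continuous_deriv le_rfl
  obtain ⟨s₀, -, hs₀⟩ := isCompact_Icc.exists_isMaxOn (Set.nonempty_Icc.2 (zero_le_one' ℝ))
    (hc2.div (h.continuous_deriv.pow 2) fun s => pow_ne_zero 2 (h.deriv_ne_zero s)).abs.continuousOn
  -- Boundedness must be supplied, since an unbounded real supremum is 0 by convention.
  refine le_ciSup (f := fun x => |circleDeriv2 T x / circleDeriv T x ^ 2|)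
    ⟨|deriv (deriv F) s₀ / deriv F s₀ ^ 2|, ?_⟩ _
  rintro _ ⟨x, rfl⟩
  obtain ⟨s, hs, hx, hx2⟩ := h.exists_Icc x
  simp only [hx, hx2]
  exact hs₀ hs

theorem IsInverseLift.abs_inv_sub_le (h : IsInverseLift T F G d) (s t : ℝ) :
    |G s - G t| ≤ (dilation T)⁻¹ * |s - t| := by
  refine Convex.norm_image_sub_le_of_norm_hasDerivWithin_le (s := Set.univ)
    (fun x _ => (h.hasDerivAt x).hasDerivWithinAt) (fun x _ => ?_) convex_univ trivial trivial
  rw [norm_inv]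
  exact inv_anti₀ h.dilation_pos (h.dilation_le _)

/-- The derivative of `log (F' ∘ G)` is `F'' / (F')²` at `G`. As `Real.log` is the logarithm of the
absolute value, both orientations are covered. -/
theorem IsInverseLift.abs_log_deriv_sub_le (h : IsInverseLift T F G d) (s t : ℝ) :
    |Real.log (deriv F (G s)) - Real.log (deriv F (G t))| ≤ distortion T * |s - t| := by
  have hd : Differentiable ℝ (deriv F) :=
    (((contDiff_succ_iff_deriv (n := 1)).1
      (by simpa [one_add_one_eq_two] using h.isC2Lift.1)).2.2).differentiable one_ne_zero
  refine Convex.norm_image_sub_le_of_norm_hasDerivWithin_le (s := Set.univ)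
    (f := fun s => Real.log (deriv F (G s)))
    (fun x _ => (((hd (G x)).hasDerivAt.comp x (h.hasDerivAt x)).log
      (h.deriv_ne_zero _)).hasDerivWithinAt) (fun x _ => ?_) convex_univ trivial trivial
  refine le_trans (le_of_eq ?_) (h.le_distortion (G x))
  rw [Real.norm_eq_abs, Function.comp_apply, ← div_eq_mul_inv, div_div, ← sq]

theorem IsInverseLift.weight_le (h : IsInverseLift T F G d) (s t : ℝ) :
    |deriv F (G s)|⁻¹ ≤ Real.exp (distortion T * |s - t|) * |deriv F (G t)|⁻¹ := by
  have h1 : ∀ s, |deriv F (G s)|⁻¹ = Real.exp (-Real.log (deriv F (G s))) := fun s => by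
    rw [Real.exp_neg, Real.exp_log_eq_abs (h.deriv_ne_zero _)]
  rw [h1, h1, ← Real.exp_add, Real.exp_le_exp]
  have := (abs_le.1 (h.abs_log_deriv_sub_le s t)).1
  linarith

/-- On each branch the contraction of `G` acts on `f` and the distortion bound on the weight. The
same exponential factor serves all branches, so it survives the sum. Working with lifts lets
branches be compared index by index. -/
theorem IsInverseLift.isLogLipschitz_transfer (h : IsInverseLift T F G d) {K : ℝ} (hK : 0 ≤ K)
    {f : UnitAddCircle → ℝ} (hf0 : ∀ x, 0 ≤ f x) (hf : IsLogLipschitz K f) :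
    IsLogLipschitz ((dilation T)⁻¹ * K + distortion T) (transfer T f) := by
  intro s t
  rw [h.transfer_coe, h.transfer_coe, Finset.mul_sum]
  refine Finset.sum_le_sum fun k _ => ?_
  have e : |s + k - (t + k)| = |s - t| := by rw [add_sub_add_right_eq_sub]
  have h1 : f (G (s + k) : ℝ) ≤ Real.exp ((dilation T)⁻¹ * K * |s - t|) * f (G (t + k) : ℝ) := by
    refine (hf _ _).trans (mul_le_mul_of_nonneg_right (Real.exp_le_exp.2 ?_) (hf0 _))
    have := mul_le_mul_of_nonneg_left (h.abs_inv_sub_le (s + k) (t + k)) hK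
    rw [e] at this
    linarith
  have h2 := h.weight_le (s + k) (t + k)
  rw [e] at h2
  calc _ ≤ (Real.exp ((dilation T)⁻¹ * K * |s - t|) * f (G (t + k) : ℝ)) *
        (Real.exp (distortion T * |s - t|) * |deriv F (G (t + k))|⁻¹) :=
        mul_le_mul h1 h2 (by positivity) (mul_nonneg (Real.exp_nonneg _) (hf0 _))
    _ = _ := by rw [add_mul, Real.exp_add]; ring

/-- Every point has a lift within distance 1 of that of `x`, so `f ≤ e^K f x` throughout; integrate.
-/
theorem IsLogLipschitz.exp_mul_integral_le {K : ℝ} (hK : 0 ≤ K) {f : UnitAddCircle → ℝ}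
    (hf0 : ∀ x, 0 ≤ f x) (hfc : Continuous f) (hf : IsLogLipschitz K f) (x : UnitAddCircle) :
    Real.exp (-K) * ∫ y, f y ≤ f x := by
  obtain ⟨t, rfl⟩ := QuotientAddGroup.mk_surjective x
  have h1 : ∫ y, f y ≤ Real.exp K * f (t : UnitAddCircle) := by
    rw [← UnitAddCircle.integral_preimage t]
    have h2 : ∫ s in Set.Ioc t (t + 1), f (s : ℝ) ≤
        ∫ s in Set.Ioc t (t + 1), Real.exp K * f (t : UnitAddCircle) := by
      refine setIntegral_mono_on ?_ (integrable_const _) measurableSet_Ioc fun s hs => ?_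
      · exact (UnitAddCircle.measurePreserving_mk t).integrable_comp_of_integrable
          (integrable_of_continuous hfc)
      · refine (hf s t).trans (mul_le_mul_of_nonneg_right (Real.exp_le_exp.2 ?_) (hf0 _))
        have : |s - t| ≤ 1 := abs_le.2 ⟨by linarith [hs.1], by linarith [hs.2]⟩
        nlinarith
    simpa using h2
  calc _ ≤ Real.exp (-K) * (Real.exp K * f (t : UnitAddCircle)) :=
        mul_le_mul_of_nonneg_left h1 (Real.exp_nonneg _)
    _ = _ := by rw [← mul_assoc, ← Real.exp_add]; simp

/-- Convexity of `exp` between `(1 + δ) y` and `0`, with weights `1 - κ` and `κ`, gives `e^y ≤ (1 -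
κ) e^{(1 + δ) y} + κ`. The slack `κ (e^{(1 + δ) y} - 1) f t` pays for the subtracted constant
because `c ≤ κ f t`. -/
theorem IsLogLipschitz.sub_const {K κ δ c : ℝ} (hκ0 : 0 ≤ κ) (hκ1 : κ ≤ 1)
    (hκδ : (1 - κ) * (1 + δ) = 1) {f : UnitAddCircle → ℝ} (hf0 : ∀ x, 0 ≤ f x)
    (hf : IsLogLipschitz K f) (hK : 0 ≤ K) (hδ : 0 ≤ δ) (hc : ∀ x, c ≤ κ * f x) :
    IsLogLipschitz ((1 + δ) * K) fun x => f x - c := by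
  intro s t
  set y := K * |s - t| with hy
  have hy0 : 0 ≤ y := by positivity
  have h1 := hf s t
  have h2 : Real.exp y ≤ (1 - κ) * Real.exp ((1 + δ) * y) + κ := by
    have := convexOn_exp.2 (Set.mem_univ ((1 + δ) * y)) (Set.mem_univ 0)
      (sub_nonneg.2 hκ1) hκ0 (sub_add_cancel 1 κ)
    simp only [smul_eq_mul, ← mul_assoc, hκδ, one_mul, mul_zero, add_zero, Real.exp_zero,
      mul_one] at this
    exact this
  have h3 : 1 ≤ Real.exp ((1 + δ) * y) := Real.one_le_exp (by positivity)
  rw [mul_assoc, ← hy]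
  have h4 := mul_le_mul_of_nonneg_right h2 (hf0 (t : UnitAddCircle))
  have h5 := mul_le_mul_of_nonneg_right (hc (t : UnitAddCircle)) (sub_nonneg.2 h3)
  nlinarith

end LogLipschitz

@[simp]
theorem volume_real_univ : (volume : Measure UnitAddCircle).real Set.univ = 1 := by
  rw [measureReal_def, UnitAddCircle.measure_univ, ENNReal.toReal_one]

/-! ### Products of transfer operators -/

section TransferComp

variable {Ω : Type*} {T : Ω → UnitAddCircle → UnitAddCircle}

theorem transferComp_add (hT : ∀ i, ∃ F G d, IsInverseLift (T i) F G d) (ω : ℕ → Ω) (n : ℕ)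
    (u v : UnitAddCircle → ℝ) :
    transferComp T ω n (u + v) = transferComp T ω n u + transferComp T ω n v := by
  induction n with
  | zero => rfl
  | succ n ih =>
    obtain ⟨F, G, d, h⟩ := hT (ω n)
    simp only [transferComp, ih, h.transfer_add]

theorem transferComp_smul (hT : ∀ i, ∃ F G d, IsInverseLift (T i) F G d) (ω : ℕ → Ω) (n : ℕ)
    (c : ℝ) (u : UnitAddCircle → ℝ) :
    transferComp T ω n (c • u) = c • transferComp T ω n u := by
  induction n with
  | zero => rfl
  | succ n ih =>
    obtain ⟨F, G, d, h⟩ := hT (ω n)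
    simp only [transferComp, ih, h.transfer_smul]

theorem continuous_transferComp (hT : ∀ i, ∃ F G d, IsInverseLift (T i) F G d) (ω : ℕ → Ω)
    (n : ℕ) {u : UnitAddCircle → ℝ} (hu : Continuous u) : Continuous (transferComp T ω n u) := by
  induction n with
  | zero => exact hu
  | succ n ih =>
    obtain ⟨F, G, d, h⟩ := hT (ω n)
    exact h.continuous_transfer ih

theorem integral_abs_transferComp_le (hT : ∀ i, ∃ F G d, IsInverseLift (T i) F G d) (ω : ℕ → Ω)
    (n : ℕ) {u : UnitAddCircle → ℝ} (hu : Continuous u) :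
    ∫ x, |transferComp T ω n u x| ≤ ∫ x, |u x| := by
  induction n with
  | zero => exact le_rfl
  | succ n ih =>
    obtain ⟨F, G, d, h⟩ := hT (ω n)
    exact (h.integral_abs_transfer_le (continuous_transferComp hT ω n hu)).trans ih

theorem integral_abs_transferComp_add_le (hT : ∀ i, ∃ F G d, IsInverseLift (T i) F G d)
    (ω : ℕ → Ω) (n : ℕ) {u v : UnitAddCircle → ℝ} (hu : Continuous u) (hv : Continuous v) :
    ∫ x, |transferComp T ω n (u + v) x| ≤ (∫ x, |u x|) + ∫ x, |transferComp T ω n v x| := by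
  have hcu := integrable_of_continuous (continuous_transferComp hT ω n hu).abs
  have hcv := integrable_of_continuous (continuous_transferComp hT ω n hv).abs
  refine le_trans ?_ (add_le_add_left (integral_abs_transferComp_le hT ω n hu) _)
  rw [transferComp_add hT, ← integral_add hcu hcv]
  refine integral_mono (integrable_of_continuous ?_) (hcu.add hcv) fun x => abs_add_le _ _
  exact ((continuous_transferComp hT ω n hu).add (continuous_transferComp hT ω n hv)).abs

variable {E : Type*} [NormedAddCommGroup E]

theorem integrable_comp [NormedSpace ℝ E] (hT : ∀ i, ∃ F G d, IsInverseLift (T i) F G d)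
    (ω : ℕ → Ω) (n : ℕ) {g : UnitAddCircle → E} (hg : Integrable g) :
    Integrable fun x => g (comp T ω n x) := by
  induction n generalizing g with
  | zero => exact hg
  | succ n ih =>
    obtain ⟨F, G, d, h⟩ := hT (ω n)
    exact ih (g := fun x => g (T (ω n) x)) (h.integrable_comp hg)

theorem integral_smul_comp [NormedSpace ℝ E] (hT : ∀ i, ∃ F G d, IsInverseLift (T i) F G d)
    (ω : ℕ → Ω) (n : ℕ) {u : UnitAddCircle → ℝ} (hu : Continuous u) {g : UnitAddCircle → E}
    (hg : Integrable g) :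
    ∫ x, u x • g (comp T ω n x) = ∫ x, transferComp T ω n u x • g x := by
  induction n generalizing g with
  | zero => rfl
  | succ n ih =>
    obtain ⟨F, G, d, h⟩ := hT (ω n)
    refine (ih (g := fun x => g (T (ω n) x)) (h.integrable_comp hg)).trans ?_
    exact h.integral_smul_comp (continuous_transferComp hT ω n hu) hg

theorem norm_integral_smul_comp_le [NormedSpace ℝ E]
    (hT : ∀ i, ∃ F G d, IsInverseLift (T i) F G d)
    (ω : ℕ → Ω) (n : ℕ) {u : UnitAddCircle → ℝ} (hu : Continuous u) {g : UnitAddCircle → E}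
    (hg : MemLp g ∞ volume) :
    ‖∫ x, u x • g (comp T ω n x)‖ ≤
      (eLpNorm g ∞ volume).toReal * ∫ x, |transferComp T ω n u x| := by
  rw [integral_smul_comp hT ω n hu (hg.integrable le_top), ← integral_const_mul]
  refine norm_integral_le_of_norm_le
    ((integrable_of_continuous (continuous_transferComp hT ω n hu).abs).const_mul _) ?_
  have h1 : ∀ᵐ x, ‖g x‖ₑ ≤ eLpNorm g ∞ volume := by
    rw [eLpNorm_exponent_top]; exact ae_le_eLpNormEssSup
  filter_upwards [h1] with x hx
  rw [norm_smul, mul_comm, Real.norm_eq_abs]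
  refine mul_le_mul_of_nonneg_right ?_ (abs_nonneg _)
  rw [← toReal_enorm]
  exact ENNReal.toReal_mono hg.2.ne hx

end TransferComp

/-! ### Mixing -/

/-- A bound for the logarithmic regularity of the densities after `n` steps, when the `j`-th map
has inverse dilation `a j` and distortion `b j`, and a constant is split off at each step. -/
noncomputable def logBound (δ : ℝ) (a b : ℕ → ℝ) : ℕ → ℝ
  | 0 => 1
  | n + 1 => (1 + δ) * a n * logBound δ a b n + b n

/-- The mass that is left after splitting off constants in `n` steps. -/
noncomputable def remMass (κ δ : ℝ) (a b : ℕ → ℝ) : ℕ → ℝ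
  | 0 => 1
  | n + 1 => remMass κ δ a b n * (1 - κ * Real.exp (-logBound δ a b n))

theorem logBound_nonneg {δ : ℝ} {a b : ℕ → ℝ} (hδ : 0 ≤ δ) (ha : ∀ n, 0 ≤ a n) (hb : ∀ n, 0 ≤ b n)
    (n : ℕ) : 0 ≤ logBound δ a b n := by
  induction n with
  | zero => exact zero_le_one
  | succ n ih =>
    have := ha n
    have := hb n
    rw [logBound]; positivity

theorem splitFactor_mem {κ r : ℝ} (hκ0 : 0 ≤ κ) (hκ1 : κ ≤ 1) (hr : 0 ≤ r) :
    1 - κ * Real.exp (-r) ∈ Set.Icc (0 : ℝ) 1 := by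
  have h1 : Real.exp (-r) ≤ 1 := Real.exp_le_one_iff.2 (by linarith)
  have h2 := Real.exp_nonneg (-r)
  constructor <;> nlinarith

theorem remMass_mem {κ δ : ℝ} {a b : ℕ → ℝ} (hκ0 : 0 ≤ κ) (hκ1 : κ ≤ 1) (hδ : 0 ≤ δ)
    (ha : ∀ n, 0 ≤ a n) (hb : ∀ n, 0 ≤ b n) (n : ℕ) : remMass κ δ a b n ∈ Set.Icc (0 : ℝ) 1 := by
  induction n with
  | zero => simp [remMass]
  | succ n ih =>
    have h := splitFactor_mem hκ0 hκ1 (logBound_nonneg hδ ha hb n)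
    exact ⟨mul_nonneg ih.1 h.1, mul_le_one₀ ih.2 h.1 h.2⟩

/-- Continuous nonnegative functions of given mass and logarithmic regularity. -/
structure IsRegular (K m : ℝ) (f : UnitAddCircle → ℝ) : Prop where
  continuous : Continuous f
  nonneg : ∀ x, 0 ≤ f x
  isLogLipschitz : IsLogLipschitz K f
  integral_eq : ∫ x, f x = m

theorem IsRegular.transfer {T : UnitAddCircle → UnitAddCircle} {F G : ℝ → ℝ} {d : ℤ}
    (h : IsInverseLift T F G d) {K m : ℝ} (hK : 0 ≤ K) {f : UnitAddCircle → ℝ}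
    (hf : IsRegular K m f) :
    IsRegular ((dilation T)⁻¹ * K + distortion T) m (transfer T f) where
  continuous := h.continuous_transfer hf.continuous
  nonneg := transfer_nonneg hf.nonneg
  isLogLipschitz := h.isLogLipschitz_transfer hK hf.nonneg hf.isLogLipschitz
  integral_eq := by rw [h.integral_transfer hf.continuous, hf.integral_eq]

/-- The removed constant depends on `K` and `m` alone, so two functions with the same data lose the
same constant. -/
theorem IsRegular.sub_const {κ δ K m : ℝ} (hκ0 : 0 ≤ κ) (hκ1 : κ ≤ 1) (hδ : 0 ≤ δ)
    (hκδ : (1 - κ) * (1 + δ) = 1) (hK : 0 ≤ K) {f : UnitAddCircle → ℝ} (hf : IsRegular K m f) :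
    IsRegular ((1 + δ) * K) (m * (1 - κ * Real.exp (-K)))
      (fun x => f x - κ * (Real.exp (-K) * m)) := by
  have h1 : ∀ x, κ * (Real.exp (-K) * m) ≤ κ * f x := fun x => by
    rw [← hf.integral_eq]
    exact mul_le_mul_of_nonneg_left
      (hf.isLogLipschitz.exp_mul_integral_le hK hf.nonneg hf.continuous x) hκ0
  refine ⟨hf.continuous.sub continuous_const, fun x => ?_,
    hf.isLogLipschitz.sub_const hκ0 hκ1 hκδ hf.nonneg hK hδ h1, ?_⟩
  · have := h1 x
    have := mul_le_mul_of_nonneg_right hκ1 (hf.nonneg x)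
    linarith
  · rw [integral_sub (integrable_of_continuous hf.continuous) (integrable_const _), hf.integral_eq]
    rw [integral_const, volume_real_univ, one_smul]
    ring

section Mixing

variable {Ω : Type*} {T : Ω → UnitAddCircle → UnitAddCircle} {κ δ : ℝ}

theorem exists_isRegular_transferComp (hT : ∀ i, ∃ F G d, IsInverseLift (T i) F G d) (ω : ℕ → Ω)
    (hκ0 : 0 ≤ κ) (hκ1 : κ ≤ 1) (hδ : 0 ≤ δ) (hκδ : (1 - κ) * (1 + δ) = 1)
    {f₁ f₂ : UnitAddCircle → ℝ} (h₁ : IsRegular 1 1 f₁) (h₂ : IsRegular 1 1 f₂) (n : ℕ) :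
    let a := fun j => (dilation (T (ω j)))⁻¹
    let b := fun j => distortion (T (ω j))
    ∃ g₁ g₂, IsRegular (logBound δ a b n) (remMass κ δ a b n) g₁ ∧
      IsRegular (logBound δ a b n) (remMass κ δ a b n) g₂ ∧
      transferComp T ω n (f₁ - f₂) = g₁ - g₂ := by
  intro a b
  induction n with
  | zero => exact ⟨f₁, f₂, h₁, h₂, rfl⟩
  | succ n ih =>
    obtain ⟨g₁, g₂, hg₁, hg₂, hg⟩ := ih
    obtain ⟨F, G, d, h⟩ := hT (ω n)
    have ha : ∀ j, 0 ≤ a j := fun j => by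
      obtain ⟨F, G, d, h⟩ := hT (ω j)
      exact inv_nonneg.2 h.dilation_pos.le
    have hK : 0 ≤ logBound δ a b n := logBound_nonneg hδ ha (fun j => distortion_nonneg) n
    have hK' : 0 ≤ (1 + δ) * logBound δ a b n := by positivity
    have e : logBound δ a b (n + 1) = (dilation (T (ω n)))⁻¹ * ((1 + δ) * logBound δ a b n) +
        distortion (T (ω n)) := by
      rw [logBound]; ring
    rw [e, remMass]
    refine ⟨_, _, (hg₁.sub_const hκ0 hκ1 hδ hκδ hK).transfer h hK',
      (hg₂.sub_const hκ0 hκ1 hδ hκδ hK).transfer h hK', ?_⟩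
    rw [transferComp, hg, eq_sub_iff_add_eq, ← h.transfer_add]
    congr 1
    funext x
    simp only [Pi.add_apply, Pi.sub_apply]
    ring

theorem integral_abs_transferComp_sub_le (hT : ∀ i, ∃ F G d, IsInverseLift (T i) F G d)
    (ω : ℕ → Ω) (hκ0 : 0 ≤ κ) (hκ1 : κ ≤ 1) (hδ : 0 ≤ δ) (hκδ : (1 - κ) * (1 + δ) = 1)
    {f₁ f₂ : UnitAddCircle → ℝ} (h₁ : IsRegular 1 1 f₁) (h₂ : IsRegular 1 1 f₂) (n : ℕ) :
    ∫ x, |transferComp T ω n (f₁ - f₂) x| ≤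
      2 * remMass κ δ (fun j => (dilation (T (ω j)))⁻¹) (fun j => distortion (T (ω j))) n := by
  obtain ⟨g₁, g₂, hg₁, hg₂, hg⟩ := exists_isRegular_transferComp hT ω hκ0 hκ1 hδ hκδ h₁ h₂ n
  have i₁ := integrable_of_continuous hg₁.continuous
  have i₂ := integrable_of_continuous hg₂.continuous
  rw [hg, two_mul]
  nth_rewrite 1 [← hg₁.integral_eq]
  rw [← hg₂.integral_eq, ← integral_add i₁ i₂]
  refine integral_mono (i₁.sub i₂).abs (i₁.add i₂) fun x => ?_
  have := hg₁.nonneg x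
  have := hg₂.nonneg x
  simp only [Pi.sub_apply]
  exact abs_le.2 ⟨by linarith, by linarith⟩

/-! ### Mean zero Lipschitz functions as multiples of differences of regular densities -/

theorem isRegular_one : IsRegular 1 1 fun _ => 1 where
  continuous := continuous_const
  nonneg _ := zero_le_one
  isLogLipschitz s t := by
    rw [mul_one]; exact Real.one_le_exp (by positivity)
  integral_eq := by simp

theorem dist_coe_le (s t : ℝ) : dist (s : UnitAddCircle) (t : UnitAddCircle) ≤ |s - t| := by
  rw [dist_eq_norm, ← AddCircle.coe_sub]
  exact QuotientAddGroup.norm_mk_le_norm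

theorem dist_le_one (x y : UnitAddCircle) : dist x y ≤ 1 := by
  rw [dist_eq_norm]
  refine (AddCircle.norm_le_half_period 1 one_ne_zero).trans ?_
  norm_num

/-- Since `1 + w ≥ 1/2`, an increment of at most `|s - t| / 2` is at most the proportion `|s - t|`
of the value. This is why `logBound` may start at 1. -/
theorem isRegular_one_add {w : UnitAddCircle → ℝ} (hw : Continuous w) (hw0 : ∫ x, w x = 0)
    (hwb : ∀ x, |w x| ≤ 1 / 2) (hwl : ∀ x y, |w x - w y| ≤ 1 / 2 * dist x y) :
    IsRegular 1 1 fun x => 1 + w x where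
  continuous := continuous_const.add hw
  nonneg x := by linarith [(abs_le.1 (hwb x)).1]
  isLogLipschitz s t := by
    have h1 := (abs_le.1 (hwb (t : UnitAddCircle))).1
    have h2 := (abs_le.1 ((hwl (s : UnitAddCircle) t).trans
      (mul_le_mul_of_nonneg_left (dist_coe_le s t) (by norm_num)))).2
    have h3 := Real.add_one_le_exp (1 * |s - t|)
    have h4 := abs_nonneg (s - t)
    nlinarith
  integral_eq := by
    rw [integral_add (integrable_const _) (integrable_of_continuous hw), hw0]; simp

theorem integral_abs_transferComp_le_of_lipschitz (hT : ∀ i, ∃ F G d, IsInverseLift (T i) F G d)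
    (ω : ℕ → Ω) (hκ0 : 0 ≤ κ) (hκ1 : κ ≤ 1) (hδ : 0 ≤ δ) (hκδ : (1 - κ) * (1 + δ) = 1)
    {v : UnitAddCircle → ℝ} {K : ℝ} (hK : 0 < K) (hv : Continuous v) (hv0 : ∫ x, v x = 0)
    (hvl : ∀ x y, |v x - v y| ≤ K * dist x y) (n : ℕ) :
    ∫ x, |transferComp T ω n v x| ≤ 4 * K *
      remMass κ δ (fun j => (dilation (T (ω j)))⁻¹) (fun j => distortion (T (ω j))) n := by
  have hvb : ∀ x, |v x| ≤ K := fun x => by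
    have h1 : ∫ y, (v x - v y) = v x := by
      rw [integral_sub (integrable_const _) (integrable_of_continuous hv), hv0]; simp
    rw [← h1]
    have h2 := norm_integral_le_of_norm_le_const (μ := (volume : Measure UnitAddCircle))
      (f := fun y => v x - v y) (C := K) (Filter.Eventually.of_forall fun y =>
        (hvl x y).trans (mul_le_of_le_one_right hK.le (dist_le_one x y)))
    simpa using h2
  -- A mean zero `K`-Lipschitz function on a space of diameter at most 1 is bounded by `K`, so
  -- dividing by `2 K` gives both bounds `1/2`. Undoing this scaling gives `2 K · 2 = 4 K`.
  set w : UnitAddCircle → ℝ := (2 * K)⁻¹ • v with hw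
  have hreg : IsRegular 1 1 fun x => 1 + w x := by
    refine isRegular_one_add (hv.const_smul _) ?_ (fun x => ?_) fun x y => ?_
    · simp [hw, integral_const_mul, hv0]
    · rw [hw, Pi.smul_apply, smul_eq_mul, abs_mul, abs_of_pos (by positivity), inv_mul_le_iff₀
        (by positivity)]
      linarith [hvb x]
    · rw [hw, Pi.smul_apply, Pi.smul_apply, ← smul_sub, smul_eq_mul, abs_mul,
        abs_of_pos (by positivity), inv_mul_le_iff₀ (by positivity)]
      linarith [hvl x y]
  have hv' : v = (2 * K) • ((fun x => 1 + w x) - fun _ => 1) := by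
    funext x
    simp only [hw, Pi.smul_apply, Pi.sub_apply, smul_eq_mul]
    field_simp
    ring
  have h := integral_abs_transferComp_sub_le hT ω hκ0 hκ1 hδ hκδ hreg isRegular_one n
  rw [hv', transferComp_smul hT]
  simp only [Pi.smul_apply, smul_eq_mul, abs_mul, integral_const_mul, abs_of_pos hK, abs_two]
  nlinarith

/-! ### Hölder functions -/

theorem holder_sub_le {α H ε r : ℝ} (hα0 : 0 < α) (hα1 : α ≤ 1) (hH : 0 ≤ H) (hε : 0 < ε)
    (hr : 0 ≤ r) : H * r ^ α ≤ H * ε ^ (α - 1) * r + H * ε ^ α := by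
  rw [mul_assoc, ← mul_add]
  refine mul_le_mul_of_nonneg_left ?_ hH
  rcases le_total r ε with h | h
  · have := Real.rpow_le_rpow hr h hα0.le
    have : 0 ≤ ε ^ (α - 1) * r := by positivity
    linarith
  · have hr' := hε.trans_le h
    have h1 := Real.rpow_le_rpow_of_nonpos hε h (by linarith : α - 1 ≤ 0)
    have h2 : r ^ α = r ^ (α - 1) * r := by
      rw [Real.rpow_sub_one hr'.ne', div_mul_cancel₀ _ hr'.ne']
    have h3 : 0 ≤ ε ^ α := by positivity
    rw [h2]
    nlinarith

/-- A Hölder function is approximated by a Lipschitz function, with the optimal balance between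
the error and the Lipschitz constant. -/
theorem exists_lipschitz_approx {X : Type*} [PseudoMetricSpace X] {u : X → ℝ} {α H ε : ℝ}
    (hα0 : 0 < α) (hα1 : α ≤ 1) (hH : 0 ≤ H) (hε : 0 < ε)
    (hu : ∀ x y, |u x - u y| ≤ H * dist x y ^ α) :
    ∃ v : X → ℝ, (∀ x y, |v x - v y| ≤ H * ε ^ (α - 1) * dist x y) ∧
      ∀ x, |u x - v x| ≤ H * ε ^ α := by
  set K := H * ε ^ (α - 1) with hK
  have hK0 : 0 ≤ K := by positivity
  have hlow : ∀ x y, u x - H * ε ^ α ≤ u y + K * dist x y := fun x y => by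
    have h1 := (abs_le.1 (hu x y)).2
    have h2 := holder_sub_le hα0 hα1 hH hε (dist_nonneg (x := x) (y := y))
    linarith
  have hbdd : ∀ x, BddBelow (Set.range fun y => u y + K * dist x y) := fun x =>
    ⟨u x - H * ε ^ α, by rintro _ ⟨y, rfl⟩; exact hlow x y⟩
  have hle : ∀ x y, (⨅ z, u z + K * dist x z) ≤ (⨅ z, u z + K * dist y z) + K * dist x y := by
    intro x y
    have : Nonempty X := ⟨x⟩
    rw [← sub_le_iff_le_add]
    refine le_ciInf fun z => ?_
    have h1 := ciInf_le (hbdd x) z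
    have h2 := mul_le_mul_of_nonneg_left (dist_triangle x y z) hK0
    linarith
  -- The infimal convolution with `K * dist` is `K`-Lipschitz and lies below `u`; `hlow` bounds the
  -- gap.
  refine ⟨fun x => ⨅ y, u y + K * dist x y, fun x y => ?_, fun x => ?_⟩
  · have h1 := hle x y
    have h2 := hle y x
    rw [dist_comm] at h2
    exact abs_le.2 ⟨by linarith, by linarith⟩
  · have : Nonempty X := ⟨x⟩
    have h1 := ciInf_le (hbdd x) x
    have h2 := le_ciInf (hlow x)
    simp only [dist_self, mul_zero, add_zero] at h1
    have : 0 ≤ H * ε ^ α := by positivity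
    exact abs_le.2 ⟨by linarith, by linarith⟩

theorem continuous_of_abs_sub_le {X : Type*} [PseudoMetricSpace X] {v : X → ℝ} {K : ℝ}
    (hv : ∀ x y, |v x - v y| ≤ K * dist x y) : Continuous v :=
  (LipschitzWith.of_dist_le' hv).continuous

/-- With `v` the Lipschitz approximation and `m` its mean, `v - m` decays with the remaining mass,
while `u - v + m` is uniformly small and the transfer operators do not increase its `L¹` norm. -/
theorem integral_abs_transferComp_le_of_holder (hT : ∀ i, ∃ F G d, IsInverseLift (T i) F G d)
    (ω : ℕ → Ω) (hκ0 : 0 ≤ κ) (hκ1 : κ ≤ 1) (hδ : 0 ≤ δ) (hκδ : (1 - κ) * (1 + δ) = 1)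
    {u : UnitAddCircle → ℝ} {α H ε : ℝ} (hα0 : 0 < α) (hα1 : α ≤ 1) (hH : 0 < H) (hε : 0 < ε)
    (huc : Continuous u) (hu0 : ∫ x, u x = 0)
    (hu : ∀ x y, |u x - u y| ≤ H * dist x y ^ α) (n : ℕ) :
    ∫ x, |transferComp T ω n u x| ≤ 2 * (H * ε ^ α) + 4 * (H * ε ^ (α - 1)) *
      remMass κ δ (fun j => (dilation (T (ω j)))⁻¹) (fun j => distortion (T (ω j))) n := by
  obtain ⟨v, hvl, huv⟩ := exists_lipschitz_approx hα0 hα1 hH.le hε hu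
  have hvc := continuous_of_abs_sub_le hvl
  have hiu := integrable_of_continuous huc
  have hiv := integrable_of_continuous hvc
  set m := ∫ x, v x with hm
  have hmb : |m| ≤ H * ε ^ α := by
    have h1 : ∫ x, (u x - v x) = -m := by rw [integral_sub hiu hiv, hu0, zero_sub]
    rw [← abs_neg, ← h1]
    have := norm_integral_le_of_norm_le_const (μ := (volume : Measure UnitAddCircle))
      (f := fun x => u x - v x) (Filter.Eventually.of_forall huv)
    simpa using this
  have hvm : Continuous fun x => v x - m := hvc.sub continuous_const
  have h1 := integral_abs_transferComp_le_of_lipschitz hT ω hκ0 hκ1 hδ hκδ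
    (v := fun x => v x - m) (K := H * ε ^ (α - 1)) (by positivity) hvm
    (by rw [integral_sub hiv (integrable_const _)]; simp [hm])
    (fun x y => by rw [sub_sub_sub_cancel_right]; exact hvl x y) n
  have e : u = (fun x => u x - v x + m) + fun x => v x - m := by
    funext x; simp only [Pi.add_apply]; ring
  have hcd : Continuous fun x => u x - v x + m := (huc.sub hvc).add continuous_const
  have h2 := integral_abs_transferComp_add_le hT ω n hcd hvm
  rw [← e] at h2
  have h3 : ∫ x, |u x - v x + m| ≤ 2 * (H * ε ^ α) := by
    have h4 : ∫ x, |u x - v x + m| ≤ ∫ _ : UnitAddCircle, 2 * (H * ε ^ α) := by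
      refine integral_mono (integrable_of_continuous hcd.abs) (integrable_const _) fun x => ?_
      have := (abs_add_le (u x - v x) m).trans (add_le_add (huv x) hmb)
      simp only
      linarith
    simpa using h4
  linarith

end Mixing

/-! ### Exponential decay of the remaining mass -/

/-- A Lyapunov drift condition for `1 + ε r`. For small `r` the mass factor is bounded away from 1;
for large `r` the contraction `β` of the linear term dominates. -/
theorem exists_drift {κ β D : ℝ} (hκ0 : 0 < κ) (hκ1 : κ ≤ 1) (hβ0 : 0 ≤ β) (hβ1 : β < 1)
    (hD : 0 ≤ D) : ∃ ε γ : ℝ, 0 < ε ∧ 0 < γ ∧ γ < 1 ∧ ∀ r, 0 ≤ r →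
      (1 - κ * Real.exp (-r)) * (1 + ε * D + ε * (β * r)) ≤ γ * (1 + ε * r) := by
  set R := 2 * (D + 1) / (1 - β) with hR
  have hβ : 0 < 1 - β := by linarith
  have hR0 : 0 ≤ R := by positivity
  set q := κ * Real.exp (-R) with hq
  have hq0 : 0 < q := by positivity
  have hq1 : q ≤ 1 := by
    have : Real.exp (-R) ≤ 1 := Real.exp_le_one_iff.2 (by linarith)
    nlinarith [Real.exp_nonneg (-R)]
  -- Chosen so that `(1 - q)(1 + ε D) ≤ 1 - q + ε D ≤ 1 - ε`. Likewise `R` makes `(1 - β) R / 2 = D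
  -- + 1`, so that for `r ≥ R` the gain `ε (γ - β) r` covers `ε D + (1 - γ)`.
  set ε := q / (2 * (D + 1)) with hε
  have hε0 : 0 < ε := by positivity
  have hεD : ε * (D + 1) = q / 2 := by rw [hε]; field_simp
  set γ := max (1 - ε) ((1 + β) / 2) with hγ
  have hγ1 : 1 - ε ≤ γ := le_max_left _ _
  have hγ2 : (1 + β) / 2 ≤ γ := le_max_right _ _
  refine ⟨ε, γ, hε0, by linarith, max_lt (by linarith) (by linarith), fun r hr => ?_⟩
  have hs := splitFactor_mem hκ0.le hκ1 hr
  rcases le_total r R with h | h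
  · have h1 : q ≤ κ * Real.exp (-r) :=
      mul_le_mul_of_nonneg_left (Real.exp_le_exp.2 (by linarith)) hκ0.le
    have h2 : (1 - κ * Real.exp (-r)) * (1 + ε * D) ≤ γ := by
      have h3 : 0 ≤ ε * D := by positivity
      have h4 : (1 - κ * Real.exp (-r)) * (1 + ε * D) ≤ (1 - q) * (1 + ε * D) :=
        mul_le_mul_of_nonneg_right (by linarith) (by linarith)
      nlinarith
    have h5 : (1 - κ * Real.exp (-r)) * (ε * (β * r)) ≤ γ * (ε * r) := by
      have h6 : 0 ≤ ε * (β * r) := by positivity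
      have h7 : 0 ≤ ε * r := by positivity
      have h8 := mul_le_of_le_one_left h6 hs.2
      nlinarith
    linarith
  · have h1 : 0 ≤ 1 + ε * D + ε * (β * r) := by positivity
    refine (mul_le_of_le_one_left h1 hs.2).trans ?_
    have h2 : D + 1 ≤ (γ - β) * r := by
      have h3 : R * ((1 - β) / 2) = D + 1 := by rw [hR]; field_simp
      have h4 : R * ((1 - β) / 2) ≤ r * (γ - β) :=
        mul_le_mul h (by linarith) (by linarith) hr
      linarith
    have h5 := mul_le_mul_of_nonneg_left h2 hε0.le
    nlinarith

section Random

open ProbabilityTheory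

variable {Ω : Type*} [MeasurableSpace Ω] {η : Measure Ω} [IsProbabilityMeasure η]

theorem indepFun_of_dependsOn_lt {Φ : (ℕ → Ω) → ℝ} {f : Ω → ℝ} {n : ℕ} (hΦ : Measurable Φ)
    (hdep : ∀ ω ω' : ℕ → Ω, (∀ i < n, ω i = ω' i) → Φ ω = Φ ω') (hf : Measurable f) :
    IndepFun Φ (fun ω => f (ω n)) (Measure.infinitePi fun _ : ℕ => η) := by
  obtain ⟨o⟩ : Nonempty Ω := η.nonempty_of_neZero
  have h1 : iIndepFun (fun (i : ℕ) (ω : ℕ → Ω) => ω i) (Measure.infinitePi fun _ : ℕ => η) :=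
    iIndepFun_infinitePi (X := fun _ => id) fun _ => measurable_id
  have h2 := h1.indepFun_finset (Finset.range n) {n} (by simp) fun i => measurable_pi_apply i
  -- Padding with a fixed point `o` makes `Φ` a function of the first `n` coordinates.
  let ext : ((Finset.range n) → Ω) → ℕ → Ω := fun x i =>
    if h : i ∈ Finset.range n then x ⟨i, h⟩ else o
  have hext : Measurable ext := by
    refine measurable_pi_lambda _ fun i => ?_
    by_cases h : i ∈ Finset.range n
    · simp only [ext, h, dif_pos]; exact measurable_pi_apply _
    · simp only [ext, h, dif_neg, not_false_eq_true]; exact measurable_const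
  have h3 := h2.comp (φ := fun x => Φ (ext x))
    (ψ := fun y : ({n} : Finset ℕ) → Ω => f (y ⟨n, Finset.mem_singleton_self n⟩)) (hΦ.comp hext)
    (hf.comp (measurable_pi_apply _))
  refine h3.congr (Filter.Eventually.of_forall fun ω => ?_)
    (Filter.Eventually.of_forall fun ω => rfl)
  exact hdep _ _ fun i hi => by simp [ext, hi]

variable {A B : Ω → ℝ} {κ δ : ℝ}

theorem logBound_congr {a a' b b' : ℕ → ℝ} {n : ℕ} (ha : ∀ i < n, a i = a' i)
    (hb : ∀ i < n, b i = b' i) : logBound δ a b n = logBound δ a' b' n := by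
  induction n with
  | zero => rfl
  | succ n ih =>
    rw [logBound, logBound, ih (fun i hi => ha i (by omega)) (fun i hi => hb i (by omega)),
      ha n (by omega), hb n (by omega)]

/-- The index shift matters: the mass after `n + 1` steps uses only the first `n` maps, hence is
independent of map number `n`, which enters `logBound` at step `n + 1`. -/
theorem remMass_congr {a a' b b' : ℕ → ℝ} {n : ℕ} (ha : ∀ i < n, a i = a' i)
    (hb : ∀ i < n, b i = b' i) : remMass κ δ a b (n + 1) = remMass κ δ a' b' (n + 1) := by
  induction n with
  | zero => rfl
  | succ n ih =>
    rw [remMass, ih (fun i hi => ha i (by omega)) (fun i hi => hb i (by omega)),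
      logBound_congr ha hb]
    rfl

theorem measurable_logBound (hA : Measurable A) (hB : Measurable B) (n : ℕ) :
    Measurable fun ω : ℕ → Ω => logBound δ (fun j => A (ω j)) (fun j => B (ω j)) n := by
  induction n with
  | zero => exact measurable_const
  | succ n ih =>
    exact ((measurable_const.mul (hA.comp (measurable_pi_apply n))).mul ih).add
      (hB.comp (measurable_pi_apply n))

theorem measurable_remMass (hA : Measurable A) (hB : Measurable B) (n : ℕ) :
    Measurable fun ω : ℕ → Ω => remMass κ δ (fun j => A (ω j)) (fun j => B (ω j)) n := by
  induction n with
  | zero => exact measurable_const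
  | succ n ih =>
    exact ih.mul (measurable_const.sub (measurable_const.mul
      (measurable_logBound hA hB n).neg.exp))

theorem integrable_remMass (hA : Measurable A) (hB : Measurable B) (hA0 : ∀ x, 0 ≤ A x)
    (hB0 : ∀ x, 0 ≤ B x) (hκ0 : 0 ≤ κ) (hκ1 : κ ≤ 1) (hδ : 0 ≤ δ) (n : ℕ) :
    Integrable (fun ω : ℕ → Ω => remMass κ δ (fun j => A (ω j)) (fun j => B (ω j)) n)
      (Measure.infinitePi fun _ : ℕ => η) := by
  refine (integrable_const (1 : ℝ)).mono' (measurable_remMass hA hB n).aestronglyMeasurable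
    (Filter.Eventually.of_forall fun ω => ?_)
  have := remMass_mem (κ := κ) (δ := δ) hκ0 hκ1 hδ (fun j => hA0 (ω j)) (fun j => hB0 (ω j)) n
  rw [Real.norm_of_nonneg this.1]
  exact this.2

/-- Integrating out the `n`-th coordinate in `remMass (n + 1) * logBound (n + 1)`. -/
theorem integral_remMass_mul_logBound_succ (hA : Measurable A) (hB : Measurable B)
    (hA0 : ∀ x, 0 ≤ A x) (hB0 : ∀ x, 0 ≤ B x) (hiA : Integrable A η) (hiB : Integrable B η)
    (hκ0 : 0 ≤ κ) (hκ1 : κ ≤ 1) (hδ : 0 ≤ δ) (n : ℕ) :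
    let P := Measure.infinitePi fun _ : ℕ => η
    let r := fun n (ω : ℕ → Ω) => logBound δ (fun j => A (ω j)) (fun j => B (ω j)) n
    let M := fun n (ω : ℕ → Ω) => remMass κ δ (fun j => A (ω j)) (fun j => B (ω j)) n
    Integrable (fun ω => M n ω * r n ω) P →
    Integrable (fun ω => M (n + 1) ω * r n ω) P ∧
    Integrable (fun ω => M (n + 1) ω * r (n + 1) ω) P ∧
    ∫ ω, M (n + 1) ω * r (n + 1) ω ∂P =
      (∫ ω, M (n + 1) ω ∂P) * (∫ x, B x ∂η) +
        (1 + δ) * ((∫ ω, M (n + 1) ω * r n ω ∂P) * ∫ x, A x ∂η) := by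
  intro P r M hMr
  have hr0 : ∀ ω, 0 ≤ r n ω := fun ω =>
    logBound_nonneg hδ (fun j => hA0 (ω j)) (fun j => hB0 (ω j)) n
  have hM0 : ∀ k ω, M k ω ∈ Set.Icc (0 : ℝ) 1 := fun k ω =>
    remMass_mem hκ0 hκ1 hδ (fun j => hA0 (ω j)) (fun j => hB0 (ω j)) k
  have hrm : Measurable (r n) := measurable_logBound hA hB n
  have hMm : Measurable (M (n + 1)) := measurable_remMass hA hB (n + 1)
  have hM1 : Integrable (M (n + 1)) P := integrable_remMass hA hB hA0 hB0 hκ0 hκ1 hδ (n + 1)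
  have hY : Integrable (fun ω => M (n + 1) ω * r n ω) P := by
    refine hMr.mono' (hMm.mul hrm).aestronglyMeasurable (Filter.Eventually.of_forall fun ω => ?_)
    rw [Real.norm_of_nonneg (mul_nonneg (hM0 _ ω).1 (hr0 ω))]
    refine mul_le_mul_of_nonneg_right ?_ (hr0 ω)
    exact mul_le_of_le_one_right (hM0 n ω).1 (splitFactor_mem hκ0 hκ1 (hr0 ω)).2
  have hev : MeasurePreserving (fun ω : ℕ → Ω => ω n) P η :=
    measurePreserving_eval_infinitePi (fun _ : ℕ => η) n
  have hdepM : ∀ ω ω' : ℕ → Ω, (∀ i < n, ω i = ω' i) → M (n + 1) ω = M (n + 1) ω' :=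
    fun ω ω' h => remMass_congr (fun i hi => by simp only [h i hi])
      fun i hi => by simp only [h i hi]
  have hdepr : ∀ ω ω' : ℕ → Ω, (∀ i < n, ω i = ω' i) → r n ω = r n ω' :=
    fun ω ω' h => logBound_congr (fun i hi => by simp only [h i hi])
      fun i hi => by simp only [h i hi]
  have hindB : IndepFun (M (n + 1)) (fun ω => B (ω n)) P :=
    indepFun_of_dependsOn_lt hMm hdepM hB
  have hindA : IndepFun (fun ω => M (n + 1) ω * r n ω) (fun ω => A (ω n)) P :=
    indepFun_of_dependsOn_lt (hMm.mul hrm) (fun ω ω' h => by rw [hdepM _ _ h, hdepr _ _ h]) hA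
  have hiA' : Integrable (fun ω => A (ω n)) P := hev.integrable_comp_of_integrable hiA
  have hiB' : Integrable (fun ω => B (ω n)) P := hev.integrable_comp_of_integrable hiB
  have hI1 := hindB.integrable_mul hM1 hiB'
  have hI2 := hindA.integrable_mul hY hiA'
  have e : (fun ω => M (n + 1) ω * r (n + 1) ω) = fun ω =>
      (M (n + 1) * fun ω : ℕ → Ω => B (ω n)) ω +
        (1 + δ) * ((fun ω => M (n + 1) ω * r n ω) * fun ω : ℕ → Ω => A (ω n)) ω := by
    funext ω
    simp only [Pi.mul_apply, r, logBound]
    ring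
  have eA : ∫ ω, A (ω n) ∂P = ∫ x, A x ∂η := by
    rw [← hev.map_eq, integral_map hev.measurable.aemeasurable hA.aestronglyMeasurable]
  have eB : ∫ ω, B (ω n) ∂P = ∫ x, B x ∂η := by
    rw [← hev.map_eq, integral_map hev.measurable.aemeasurable hB.aestronglyMeasurable]
  refine ⟨hY, ?_, ?_⟩
  · rw [e]; exact hI1.add (hI2.const_mul _)
  · rw [e, integral_add hI1 (hI2.const_mul _), integral_const_mul,
      hindB.integral_mul_eq_mul_integral hM1.1 hiB'.1,
      hindA.integral_mul_eq_mul_integral hY.1 hiA'.1, eA, eB]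

theorem exists_integral_remMass_le (hA : Measurable A) (hB : Measurable B)
    (hA0 : ∀ x, 0 ≤ A x) (hB0 : ∀ x, 0 ≤ B x) (hiA : Integrable A η) (hiB : Integrable B η)
    (hκ0 : 0 < κ) (hκ1 : κ ≤ 1) (hδ : 0 ≤ δ) (hδA : (1 + δ) * ∫ x, A x ∂η < 1) :
    ∃ c γ : ℝ, 0 < c ∧ 0 < γ ∧ γ < 1 ∧ ∀ n,
      ∫ ω, remMass κ δ (fun j => A (ω j)) (fun j => B (ω j)) n
        ∂(Measure.infinitePi fun _ : ℕ => η) ≤ c * γ ^ n := by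
  have hA1 : 0 ≤ ∫ x, A x ∂η := integral_nonneg hA0
  obtain ⟨ε, γ, hε, hγ0, hγ1, hdrift⟩ := exists_drift hκ0 hκ1 (β := (1 + δ) * ∫ x, A x ∂η)
    (by positivity) hδA (integral_nonneg hB0 : 0 ≤ ∫ x, B x ∂η)
  set P := Measure.infinitePi fun _ : ℕ => η with hP
  set r := fun n (ω : ℕ → Ω) => logBound δ (fun j => A (ω j)) (fun j => B (ω j)) n with hr
  set M := fun n (ω : ℕ → Ω) => remMass κ δ (fun j => A (ω j)) (fun j => B (ω j)) n with hM
  have hr0 : ∀ n ω, 0 ≤ r n ω := fun n ω =>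
    logBound_nonneg hδ (fun j => hA0 (ω j)) (fun j => hB0 (ω j)) n
  have hM0 : ∀ n ω, 0 ≤ M n ω := fun n ω =>
    (remMass_mem hκ0.le hκ1 hδ (fun j => hA0 (ω j)) (fun j => hB0 (ω j)) n).1
  have hMi : ∀ n, Integrable (M n) P := integrable_remMass hA hB hA0 hB0 hκ0.le hκ1 hδ
  have hstep := integral_remMass_mul_logBound_succ hA hB hA0 hB0 hiA hiB hκ0.le hκ1 hδ
  have hMr : ∀ n, Integrable (fun ω => M n ω * r n ω) P := by
    intro n
    induction n with
    | zero => simp [hM, hr, remMass, logBound]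
    | succ n ih => exact (hstep n ih).2.1
  -- The mean of `M (1 + ε r)` contracts by `γ`; it starts at `1 + ε` because both recursions start
  -- at 1.
  have hbound : ∀ n, (∫ ω, M n ω ∂P) + ε * ∫ ω, M n ω * r n ω ∂P ≤ (1 + ε) * γ ^ n := by
    intro n
    induction n with
    | zero => simp [hM, hr, remMass, logBound]
    | succ n ih =>
      obtain ⟨hY, -, he⟩ := hstep n (hMr n)
      change ∫ ω, M (n + 1) ω * r (n + 1) ω ∂P = _ at he
      rw [he]
      have hle : ∫ ω, (M (n + 1) ω * (1 + ε * ∫ x, B x ∂η) +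
          ε * ((1 + δ) * ∫ x, A x ∂η) * (M (n + 1) ω * r n ω)) ∂P ≤
          ∫ ω, γ * (M n ω + ε * (M n ω * r n ω)) ∂P := by
        refine integral_mono (((hMi _).mul_const _).add (hY.const_mul _))
          (((hMi n).add ((hMr n).const_mul ε)).const_mul γ) fun ω => ?_
        have h1 := mul_le_mul_of_nonneg_left (hdrift (r n ω) (hr0 n ω)) (hM0 n ω)
        have h2 : M (n + 1) ω = M n ω * (1 - κ * Real.exp (-r n ω)) := rfl
        simp only [h2]
        linarith
      rw [integral_add ((hMi _).mul_const _) (hY.const_mul _), integral_mul_const,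
        integral_const_mul, integral_const_mul, integral_add (hMi n) ((hMr n).const_mul ε),
        integral_const_mul] at hle
      have h3 := mul_le_mul_of_nonneg_left ih hγ0.le
      rw [pow_succ]
      linarith
  refine ⟨1 + ε, γ, by linarith, hγ0, hγ1, fun n => ?_⟩
  have h1 : 0 ≤ ∫ ω, M n ω * r n ω ∂P := integral_nonneg fun ω => mul_nonneg (hM0 n ω) (hr0 n ω)
  have h2 := hbound n
  have h3 : 0 ≤ ε * ∫ ω, M n ω * r n ω ∂P := by positivity
  linarith

/-- The series of `θ⁻ⁿ M n` has integral bounded by a geometric series of ratio `γ / θ`, so it is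
finite almost everywhere, and its sum bounds every term. -/
theorem ae_exists_le_mul_pow {X : Type*} [MeasurableSpace X] {μ : Measure X} {M : ℕ → X → ℝ}
    {c γ θ : ℝ} (hM : ∀ n, Integrable (M n) μ) (hM0 : ∀ n x, 0 ≤ M n x) (hγ : 0 ≤ γ)
    (hγθ : γ < θ) (hle : ∀ n, ∫ x, M n x ∂μ ≤ c * γ ^ n) :
    ∀ᵐ x ∂μ, ∃ C : ℝ, 0 < C ∧ ∀ n, M n x ≤ C * θ ^ n := by
  have hθ : 0 < θ := hγ.trans_lt hγθ
  have hc : 0 ≤ c := by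
    have := (integral_nonneg (hM0 0)).trans (hle 0)
    simpa using this
  have hmeas : ∀ n, AEMeasurable (fun x => ENNReal.ofReal ((θ ^ n)⁻¹ * M n x)) μ := fun n =>
    ((hM n).1.aemeasurable.const_mul _).ennreal_ofReal
  have hsum : ∫⁻ x, ∑' n, ENNReal.ofReal ((θ ^ n)⁻¹ * M n x) ∂μ ≠ ∞ := by
    rw [lintegral_tsum hmeas]
    have h1 : ∀ n, ∫⁻ x, ENNReal.ofReal ((θ ^ n)⁻¹ * M n x) ∂μ ≤
        ENNReal.ofReal (c * (γ / θ) ^ n) := fun n => by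
      rw [← ofReal_integral_eq_lintegral_ofReal ((hM n).const_mul _)
        (Filter.Eventually.of_forall fun x => mul_nonneg (by positivity) (hM0 n x)),
        integral_const_mul]
      refine ENNReal.ofReal_le_ofReal ?_
      rw [inv_mul_le_iff₀ (by positivity), div_pow]
      refine (hle n).trans_eq ?_
      field_simp
    refine ne_top_of_le_ne_top ?_ (ENNReal.tsum_le_tsum h1)
    have h2 : Summable fun n : ℕ => c * (γ / θ) ^ n :=
      (summable_geometric_of_lt_one (by positivity) ((div_lt_one hθ).2 hγθ)).mul_left c
    exact h2.tsum_ofReal_ne_top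
  filter_upwards [ae_lt_top' (AEMeasurable.tsum hmeas) hsum] with x hx
  refine ⟨(∑' n, ENNReal.ofReal ((θ ^ n)⁻¹ * M n x)).toReal + 1, by positivity, fun n => ?_⟩
  have h1 := ENNReal.toReal_mono hx.ne
    (ENNReal.le_tsum (f := fun n => ENNReal.ofReal ((θ ^ n)⁻¹ * M n x)) n)
  rw [ENNReal.toReal_ofReal (mul_nonneg (by positivity) (hM0 n x)),
    inv_mul_le_iff₀ (by positivity)] at h1
  have h2 : 0 < θ ^ n := by positivity
  nlinarith

theorem ae_exists_remMass_le {a b : Ω → ℝ} (ha0 : ∀ x, 0 ≤ a x) (hb0 : ∀ x, 0 ≤ b x)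
    (hia : Integrable a η) (hib : Integrable b η) (ha1 : ∫ x, a x ∂η < 1) :
    ∃ κ δ θ : ℝ, 0 ≤ κ ∧ κ ≤ 1 ∧ 0 ≤ δ ∧ (1 - κ) * (1 + δ) = 1 ∧ 0 < θ ∧ θ < 1 ∧
      ∀ᵐ ω ∂(Measure.infinitePi fun _ : ℕ => η), ∃ C : ℝ, 0 < C ∧
        ∀ n, remMass κ δ (fun j => a (ω j)) (fun j => b (ω j)) n ≤ C * θ ^ n := by
  -- Integrability gives only almost everywhere measurability, so `a` and `b` are replaced by
  -- measurable nonnegative versions, which agree with them along almost every sequence.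
  obtain ⟨A, hA, hA0, haA⟩ : ∃ A : Ω → ℝ, Measurable A ∧ (∀ x, 0 ≤ A x) ∧ a =ᵐ[η] A :=
    ⟨fun x => |hia.1.mk a x|, hia.1.stronglyMeasurable_mk.measurable.abs, fun x => abs_nonneg _, by
      filter_upwards [hia.1.ae_eq_mk] with x hx
      rw [← hx, abs_of_nonneg (ha0 x)]⟩
  obtain ⟨B, hB, hB0, hbB⟩ : ∃ B : Ω → ℝ, Measurable B ∧ (∀ x, 0 ≤ B x) ∧ b =ᵐ[η] B :=
    ⟨fun x => |hib.1.mk b x|, hib.1.stronglyMeasurable_mk.measurable.abs, fun x => abs_nonneg _, by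
      filter_upwards [hib.1.ae_eq_mk] with x hx
      rw [← hx, abs_of_nonneg (hb0 x)]⟩
  set p := ∫ x, a x ∂η with hp
  have hpA : ∫ x, A x ∂η = p := (integral_congr_ae haA).symm
  have hp0 : 0 ≤ p := integral_nonneg ha0
  -- Half of the gap keeps `(1 + δ) p < 1`; `κ` then solves `(1 - κ)(1 + δ) = 1`.
  set δ := (1 - p) / 2 with hδ
  have hδ0 : 0 < δ := by linarith
  set κ := δ / (1 + δ) with hκ
  have hκ0 : 0 < κ := by positivity
  have hκ1 : κ ≤ 1 := (div_le_one (by positivity)).2 (by linarith)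
  have hκδ : (1 - κ) * (1 + δ) = 1 := by rw [hκ]; field_simp; ring
  obtain ⟨c, γ, -, hγ0, hγ1, hle⟩ := exists_integral_remMass_le (κ := κ) (δ := δ) hA hB hA0 hB0
    (hia.congr haA) (hib.congr hbB) hκ0 hκ1 hδ0.le (by rw [hpA, hδ]; nlinarith)
  refine ⟨κ, δ, (1 + γ) / 2, hκ0.le, hκ1, hδ0.le, hκδ, by linarith, by linarith, ?_⟩
  have hae : ∀ᵐ ω ∂(Measure.infinitePi fun _ : ℕ => η), ∀ j,
      a (ω j) = A (ω j) ∧ b (ω j) = B (ω j) := by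
    rw [ae_all_iff]
    intro j
    exact (measurePreserving_eval_infinitePi (fun _ : ℕ => η) j).quasiMeasurePreserving.ae
      (haA.and hbB)
  filter_upwards [hae, ae_exists_le_mul_pow
    (integrable_remMass hA hB hA0 hB0 hκ0.le hκ1 hδ0.le)
    (fun n ω => (remMass_mem hκ0.le hκ1 hδ0.le (fun j => hA0 (ω j)) (fun j => hB0 (ω j)) n).1)
    hγ0.le (by linarith : γ < (1 + γ) / 2) hle] with ω hω hC
  have e1 : (fun j => a (ω j)) = fun j => A (ω j) := funext fun j => (hω j).1
  have e2 : (fun j => b (ω j)) = fun j => B (ω j) := funext fun j => (hω j).2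
  rw [e1, e2]
  exact hC

end Random

/-! ### Hölder norms and densities -/

section Holder

variable {E : Type*} [NormedAddCommGroup E] {α : ℝ≥0}

theorem continuous_of_memHolder (hα : 0 < α) {f : UnitAddCircle → E} (hf : MemHolder α f) :
    Continuous f :=
  hf.holderWith.continuous hα

theorem norm_le_holderNorm (hα : 0 < α) {f : UnitAddCircle → E} (hf : MemHolder α f)
    (x : UnitAddCircle) : ‖f x‖ ≤ holderNorm α f := by
  have hb : BddAbove (Set.range fun x => ‖f x‖) :=
    (isCompact_range (continuous_of_memHolder hα hf).norm).bddAbove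
  exact (le_ciSup hb x).trans (le_add_of_nonneg_left (NNReal.coe_nonneg _))

theorem norm_sub_le_holderNorm {f : UnitAddCircle → E} (hf : MemHolder α f) (x y : UnitAddCircle) :
    ‖f x - f y‖ ≤ holderNorm α f * dist x y ^ (α : ℝ) := by
  rw [← dist_eq_norm]
  refine (hf.holderWith.dist_le x y).trans (mul_le_mul_of_nonneg_right ?_ (by positivity))
  exact le_add_of_nonneg_right (Real.iSup_nonneg fun x => norm_nonneg (f x))

theorem holderNorm_nonneg (f : UnitAddCircle → E) : 0 ≤ holderNorm α f :=
  add_nonneg (NNReal.coe_nonneg _) (Real.iSup_nonneg fun x => norm_nonneg (f x))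

theorem integral_densityMeasure [NormedSpace ℝ E] (hα : 0 < α) {ψ : UnitAddCircle → ℝ}
    (hψ : IsHolderDensity α ψ) (g : UnitAddCircle → E) :
    ∫ x, g x ∂(densityMeasure ψ) = ∫ x, ψ x • g x := by
  rw [densityMeasure, integral_withDensity_eq_integral_toReal_smul
    (continuous_of_memHolder hα hψ.memHolder).measurable.ennreal_ofReal
    (Filter.Eventually.of_forall fun x => ENNReal.ofReal_lt_top)]
  simp only [ENNReal.toReal_ofReal (hψ.nonneg _)]

theorem integrable_continuous_mul {v g : UnitAddCircle → ℂ} (hv : Continuous v)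
    (hg : Integrable g) : Integrable fun x => v x * g x := by
  obtain ⟨K, hK⟩ := (isCompact_range hv.norm).bddAbove
  exact hg.bdd_mul (c := K) hv.aestronglyMeasurable
    (Filter.Eventually.of_forall fun x => hK ⟨x, rfl⟩)

theorem integral_mul_eq_re_add_im {u g : UnitAddCircle → ℂ} (hu : Continuous u)
    (hg : Integrable g) :
    ∫ x, u x * g x = (∫ x, (u x).re • g x) + Complex.I * ∫ x, (u x).im • g x := by
  simp only [Complex.real_smul]
  have hre := integrable_continuous_mul
    (Complex.continuous_ofReal.comp (Complex.continuous_re.comp hu)) hg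
  have him := integrable_continuous_mul
    (Complex.continuous_ofReal.comp (Complex.continuous_im.comp hu)) hg
  rw [← integral_const_mul]
  refine Eq.trans ?_ (integral_add hre (him.const_mul Complex.I))
  congr 1
  funext x
  conv_lhs => rw [← Complex.re_add_im (u x)]
  ring

end Holder

/-! ### Decay for Hölder functions and decay of correlations -/

section Decay

variable {Ω : Type*} {T : Ω → UnitAddCircle → UnitAddCircle} {ω : ℕ → Ω} {α : ℝ≥0} {c θ : ℝ}

/-- The transfer operators contract mean zero `α`-Hölder functions at the rate `c * θ ^ (α n)`. -/
def HasHolderDecay (T : Ω → UnitAddCircle → UnitAddCircle) (ω : ℕ → Ω) (α : ℝ≥0) (c θ : ℝ) :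
    Prop :=
  ∀ (n : ℕ) (u : UnitAddCircle → ℝ) (H : ℝ), 0 ≤ H → Continuous u → ∫ x, u x = 0 →
    (∀ x y, |u x - u y| ≤ H * dist x y ^ (α : ℝ)) →
    ∫ x, |transferComp T ω n u x| ≤ c * H * θ ^ ((α : ℝ) * n)

/-- Approximating at scale `ε = θ ^ n` balances the two errors: `ε ^ α` and `ε ^ (α - 1) θ ^ n` both
become `θ ^ (α n)`. -/
theorem hasHolderDecay_of_remMass_le {κ δ C : ℝ} (hT : ∀ i, ∃ F G d, IsInverseLift (T i) F G d)
    (hκ0 : 0 ≤ κ) (hκ1 : κ ≤ 1) (hδ : 0 ≤ δ) (hκδ : (1 - κ) * (1 + δ) = 1) (hθ : 0 < θ)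
    (hα0 : 0 < α) (hα1 : α < 1)
    (hC : ∀ n, remMass κ δ (fun j => (dilation (T (ω j)))⁻¹) (fun j => distortion (T (ω j))) n ≤
      C * θ ^ n) : HasHolderDecay T ω α (2 + 4 * C) θ := by
  intro n u H hH huc hu0 hu
  -- For `H = 0` the function is constant with mean zero, hence zero; the approximation bound needs
  -- `H > 0`.
  rcases hH.eq_or_lt with rfl | hH
  · have hu' : u = (0 : ℝ) • u := by
      funext x
      have h1 : ∀ y, u y = u x := fun y => by
        have := hu y x
        rw [zero_mul] at this
        exact sub_eq_zero.1 (abs_nonpos_iff.1 this)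
      simp only [h1, integral_const, volume_real_univ, one_smul] at hu0
      simp [hu0]
    rw [hu', transferComp_smul hT]
    simp
  · have hε : 0 < θ ^ n := by positivity
    have h1 := integral_abs_transferComp_le_of_holder hT ω hκ0 hκ1 hδ hκδ
      (NNReal.coe_pos.2 hα0) (by exact_mod_cast hα1.le) hH hε huc hu0 hu n
    have e : θ ^ ((α : ℝ) * n) = (θ ^ n) ^ (α : ℝ) := by
      rw [mul_comm, Real.rpow_natCast_mul hθ.le]
    have h2 := mul_le_mul_of_nonneg_left (hC n)
      (by positivity : 0 ≤ 4 * (H * (θ ^ n) ^ ((α : ℝ) - 1)))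
    have h3 : (θ ^ n) ^ ((α : ℝ) - 1) * θ ^ n = (θ ^ n) ^ (α : ℝ) := by
      rw [Real.rpow_sub_one hε.ne', div_mul_cancel₀ _ hε.ne']
    rw [e]
    calc _ ≤ _ := h1.trans (add_le_add_right h2 _)
      _ = 2 * (H * (θ ^ n) ^ (α : ℝ)) +
          4 * C * H * ((θ ^ n) ^ ((α : ℝ) - 1) * θ ^ n) := by ring
      _ = _ := by rw [h3]; ring

theorem HasHolderDecay.eLpNorm_le (hd : HasHolderDecay T ω α c θ)
    (hT : ∀ i, ∃ F G d, IsInverseLift (T i) F G d) (hα : 0 < α) (n : ℕ)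
    {ψ₁ ψ₂ : UnitAddCircle → ℝ} (h₁ : IsHolderDensity α ψ₁) (h₂ : IsHolderDensity α ψ₂) :
    eLpNorm (transferComp T ω n (ψ₁ - ψ₂)) 1 volume ≤
      ENNReal.ofReal (2 * c * max (holderNorm α ψ₁) (holderNorm α ψ₂) * θ ^ ((α : ℝ) * n)) := by
  have hc₁ := continuous_of_memHolder hα h₁.memHolder
  have hc₂ := continuous_of_memHolder hα h₂.memHolder
  set m := max (holderNorm α ψ₁) (holderNorm α ψ₂) with hm
  have hm0 : 0 ≤ m := (holderNorm_nonneg ψ₁).trans (le_max_left _ _)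
  rw [eLpNorm_one_eq_lintegral_enorm, ← ofReal_integral_norm_eq_lintegral_enorm
    (integrable_of_continuous (continuous_transferComp hT ω n (hc₁.sub hc₂)))]
  refine ENNReal.ofReal_le_ofReal ?_
  refine (hd n (ψ₁ - ψ₂) (2 * m) (by positivity) (hc₁.sub hc₂) ?_ fun x y => ?_).trans_eq (by ring)
  · simp only [Pi.sub_apply]
    rw [integral_sub (integrable_of_continuous hc₁) (integrable_of_continuous hc₂),
      h₁.integral_eq_one, h₂.integral_eq_one, sub_self]
  · have hd0 : 0 ≤ dist x y ^ (α : ℝ) := by positivity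
    have e₁ := (norm_sub_le_holderNorm h₁.memHolder x y).trans
      (mul_le_mul_of_nonneg_right (le_max_left _ (holderNorm α ψ₂)) hd0)
    have e₂ := (norm_sub_le_holderNorm h₂.memHolder x y).trans
      (mul_le_mul_of_nonneg_right (le_max_right (holderNorm α ψ₁) _) hd0)
    rw [Real.norm_eq_abs] at e₁ e₂
    calc |(ψ₁ - ψ₂) x - (ψ₁ - ψ₂) y| = |(ψ₁ x - ψ₁ y) - (ψ₂ x - ψ₂ y)| := by
          simp only [Pi.sub_apply]; congr 1; ring
      _ ≤ |ψ₁ x - ψ₁ y| + |ψ₂ x - ψ₂ y| := abs_sub _ _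
      _ ≤ 2 * m * dist x y ^ (α : ℝ) := by linarith

theorem HasHolderDecay.norm_integral_mul_comp_le (hd : HasHolderDecay T ω α c θ)
    (hT : ∀ i, ∃ F G d, IsInverseLift (T i) F G d) (n : ℕ) {u g : UnitAddCircle → ℂ} {H : ℝ}
    (hH : 0 ≤ H) (hu : Continuous u) (hu0 : ∫ x, u x = 0)
    (huH : ∀ x y, ‖u x - u y‖ ≤ H * dist x y ^ (α : ℝ)) (hg : MemLp g ∞ volume) :
    ‖∫ x, u x * g (comp T ω n x)‖ ≤
      2 * ((eLpNorm g ∞ volume).toReal * (c * H * θ ^ ((α : ℝ) * n))) := by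
  have hui := integrable_of_continuous hu
  have hre : Continuous fun x => (u x).re := Complex.continuous_re.comp hu
  have him : Continuous fun x => (u x).im := Complex.continuous_im.comp hu
  have key : ∀ {v : UnitAddCircle → ℝ}, Continuous v → ∫ x, v x = 0 →
      (∀ x y, |v x - v y| ≤ H * dist x y ^ (α : ℝ)) →
      ‖∫ x, v x • g (comp T ω n x)‖ ≤
        (eLpNorm g ∞ volume).toReal * (c * H * θ ^ ((α : ℝ) * n)) := fun {v} hv hv0 hvH =>
    (norm_integral_smul_comp_le hT ω n hv hg).trans
      (mul_le_mul_of_nonneg_left (hd n v H hH hv hv0 hvH) ENNReal.toReal_nonneg)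
  have hre0 : ∫ x, (u x).re = 0 := by
    have := integral_re hui
    simp only [hu0, RCLike.re_to_complex, Complex.zero_re] at this
    exact this
  have him0 : ∫ x, (u x).im = 0 := by
    have := integral_im hui
    simp only [hu0, RCLike.im_to_complex, Complex.zero_im] at this
    exact this
  have h1 := key hre hre0 fun x y => by
    rw [← Complex.sub_re]; exact (Complex.abs_re_le_norm _).trans (huH x y)
  have h2 := key him him0 fun x y => by
    rw [← Complex.sub_im]; exact (Complex.abs_im_le_norm _).trans (huH x y)
  rw [integral_mul_eq_re_add_im hu (integrable_comp hT ω n (hg.integrable le_top))]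
  refine (norm_add_le _ _).trans ?_
  rw [norm_mul, Complex.norm_I, one_mul]
  linarith

/-- The covariance is the integral of `ψ (f - m)` against `g` along the orbit, where `m` is the
`ν`-mean of `f`. This factor has mean zero and Hölder constant at most `3 ‖ψ‖ ‖f‖`; real and
imaginary parts double this to 6. -/
theorem HasHolderDecay.correlation_le (hd : HasHolderDecay T ω α c θ)
    (hT : ∀ i, ∃ F G d, IsInverseLift (T i) F G d) (hα : 0 < α) (n : ℕ)
    {ψ : UnitAddCircle → ℝ} {f g : UnitAddCircle → ℂ} (hψ : IsHolderDensity α ψ)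
    (hf : MemHolder α f) (hg : MemLp g ∞ volume) :
    ‖(∫ x, f x * g (comp T ω n x) ∂(densityMeasure ψ)) -
        (∫ x, f x ∂(densityMeasure ψ)) * ∫ x, g (comp T ω n x) ∂(densityMeasure ψ)‖ ≤
      6 * c * holderNorm α ψ * holderNorm α f * (eLpNorm g ∞ volume).toReal *
        θ ^ ((α : ℝ) * n) := by
  have hψc := continuous_of_memHolder hα hψ.memHolder
  have hfc := continuous_of_memHolder hα hf
  have hgi : Integrable fun x => g (comp T ω n x) := integrable_comp hT ω n (hg.integrable le_top)
  have hψf : Continuous fun x => ψ x • f x := hψc.smul hfc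
  simp only [integral_densityMeasure hα hψ]
  set m := ∫ x, ψ x • f x with hm
  have hmb : ‖m‖ ≤ holderNorm α f := by
    have h1 : ‖m‖ ≤ ∫ x, ψ x * holderNorm α f := by
      refine norm_integral_le_of_norm_le ((integrable_of_continuous hψc).mul_const _)
        (Filter.Eventually.of_forall fun x => ?_)
      rw [norm_smul, Real.norm_of_nonneg (hψ.nonneg x)]
      exact mul_le_mul_of_nonneg_left (norm_le_holderNorm hα hf x) (hψ.nonneg x)
    rwa [integral_mul_const, hψ.integral_eq_one, one_mul] at h1
  set u : UnitAddCircle → ℂ := fun x => ψ x • (f x - m) with hu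
  have huc : Continuous u := hψc.smul (hfc.sub continuous_const)
  have hu0 : ∫ x, u x = 0 := by
    simp only [hu, smul_sub]
    rw [integral_sub (integrable_of_continuous hψf)
      ((integrable_of_continuous hψc).smul_const m), integral_smul_const,
      hψ.integral_eq_one, one_smul, sub_self]
  have huH : ∀ x y, ‖u x - u y‖ ≤
      3 * holderNorm α ψ * holderNorm α f * dist x y ^ (α : ℝ) := fun x y => by
    have e : u x - u y = ψ x • (f x - f y) + (ψ x - ψ y) • (f y - m) := by
      simp only [hu, Complex.real_smul]; push_cast; ring
    have hd0 : 0 ≤ dist x y ^ (α : ℝ) := by positivity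
    have h1 : ‖ψ x • (f x - f y)‖ ≤ holderNorm α ψ * (holderNorm α f * dist x y ^ (α : ℝ)) := by
      rw [norm_smul]
      exact mul_le_mul (norm_le_holderNorm hα hψ.memHolder x) (norm_sub_le_holderNorm hf x y)
        (norm_nonneg _) (holderNorm_nonneg ψ)
    have h2 : ‖(ψ x - ψ y) • (f y - m)‖ ≤
        holderNorm α ψ * dist x y ^ (α : ℝ) * (2 * holderNorm α f) := by
      rw [norm_smul]
      refine mul_le_mul (norm_sub_le_holderNorm hψ.memHolder x y) ?_ (norm_nonneg _)
        (mul_nonneg (holderNorm_nonneg ψ) hd0)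
      linarith [norm_sub_le (f y) m, norm_le_holderNorm hα hf y]
    rw [e]
    linarith [norm_add_le (ψ x • (f x - f y)) ((ψ x - ψ y) • (f y - m))]
  have e : (∫ x, ψ x • (f x * g (comp T ω n x))) - m * ∫ x, ψ x • g (comp T ω n x) =
      ∫ x, u x * g (comp T ω n x) := by
    have i1 : Integrable fun x => ψ x • (f x * g (comp T ω n x)) := by
      simpa only [smul_mul_assoc] using integrable_continuous_mul hψf hgi
    have i2 : Integrable fun x => m * ψ x • g (comp T ω n x) := by
      simp only [Complex.real_smul]
      exact (integrable_continuous_mul (Complex.continuous_ofReal.comp hψc) hgi).const_mul m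
    rw [← integral_const_mul, ← integral_sub i1 i2]
    congr 1
    funext x
    simp only [hu, Complex.real_smul]
    ring
  rw [e]
  refine (hd.norm_integral_mul_comp_le hT n (mul_nonneg (mul_nonneg (by norm_num)
    (holderNorm_nonneg ψ)) (holderNorm_nonneg f)) huc hu0 huH hg).trans_eq ?_
  ring

end Decay

/-! ### From second to first moments, and conclusion -/

/-- From `f ≤ (1 + f²) / 2`, so a second moment below 1 forces a mean below 1. Measurability of `f`
is recovered as the square root of `f²`. -/
theorem integrable_of_sq {X : Type*} [MeasurableSpace X] {μ : Measure X} [IsProbabilityMeasure μ]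
    {f : X → ℝ} (hf0 : ∀ x, 0 ≤ f x) (hf : Integrable (fun x => f x ^ 2) μ) :
    Integrable f μ ∧ ∫ x, f x ∂μ ≤ (1 + ∫ x, f x ^ 2 ∂μ) / 2 := by
  have hm : AEStronglyMeasurable f μ := by
    have := Real.continuous_sqrt.comp_aestronglyMeasurable hf.1
    simpa only [Real.sqrt_sq (hf0 _)] using this
  have hle : ∀ x, f x ≤ (1 + f x ^ 2) / 2 := fun x => by nlinarith [sq_nonneg (f x - 1)]
  have hb : Integrable (fun x => (1 + f x ^ 2) / 2) μ := ((integrable_const 1).add hf).div_const 2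
  have hi : Integrable f μ := hb.mono' hm (Filter.Eventually.of_forall fun x => by
    rw [Real.norm_of_nonneg (hf0 x)]; exact hle x)
  refine ⟨hi, (integral_mono hi hb hle).trans_eq ?_⟩
  rw [integral_div, integral_add (integrable_const 1) hf]
  simp

end RandomCircle

theorem theorem2 {Ω : Type*} [MeasurableSpace Ω] (η : Measure Ω) [IsProbabilityMeasure η]
    (T : Ω → UnitAddCircle → UnitAddCircle)
    (hT_meas : Measurable fun p : Ω × UnitAddCircle => T p.1 p.2)
    (hT_C2 : ∀ ω, RandomCircle.IsC2 (T ω))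
    (hT_crit : ∀ ω x, RandomCircle.circleDeriv (T ω) x ≠ 0)
    (hlam_int : Integrable (fun ω => (RandomCircle.dilation (T ω) ^ 2)⁻¹) η)
    (hlam : ∫ ω, (RandomCircle.dilation (T ω) ^ 2)⁻¹ ∂η < 1)
    (hdelta : Integrable (fun ω => RandomCircle.distortion (T ω) ^ 2) η) :
    ∃ θ : ℝ, 0 < θ ∧ θ < 1 ∧
      ∀ α : ℝ≥0, 0 < α → α < 1 →
        ∀ᵐ ω ∂(Measure.infinitePi fun _ : ℕ => η), ∃ C : ℝ, 0 < C ∧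
          (∀ (n : ℕ) (ψ₁ ψ₂ : UnitAddCircle → ℝ),
            RandomCircle.IsHolderDensity α ψ₁ → RandomCircle.IsHolderDensity α ψ₂ →
            eLpNorm (RandomCircle.transferComp T ω n (ψ₁ - ψ₂)) 1 volume ≤
              ENNReal.ofReal
                (C * max (RandomCircle.holderNorm α ψ₁) (RandomCircle.holderNorm α ψ₂) *
                  θ ^ ((α : ℝ) * n))) ∧
          (∀ (n : ℕ) (ψ : UnitAddCircle → ℝ) (f g : UnitAddCircle → ℂ),
            RandomCircle.IsHolderDensity α ψ → MemHolder α f → MemLp g ∞ volume →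
            ‖(∫ x, f x * g (RandomCircle.comp T ω n x) ∂(RandomCircle.densityMeasure ψ)) -
                (∫ x, f x ∂(RandomCircle.densityMeasure ψ)) *
                  ∫ x, g (RandomCircle.comp T ω n x) ∂(RandomCircle.densityMeasure ψ)‖ ≤
              C * RandomCircle.holderNorm α ψ * RandomCircle.holderNorm α f *
                (eLpNorm g ∞ volume).toReal * θ ^ ((α : ℝ) * n)) := by
  have hT : ∀ ω, ∃ F G d, RandomCircle.IsInverseLift (T ω) F G d := fun ω =>
    RandomCircle.exists_isInverseLift (hT_C2 ω) (hT_crit ω)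
  have ha0 : ∀ ω, 0 ≤ (RandomCircle.dilation (T ω))⁻¹ := fun ω => by
    obtain ⟨F, G, d, h⟩ := hT ω
    exact inv_nonneg.2 h.dilation_pos.le
  have hb0 : ∀ ω, 0 ≤ RandomCircle.distortion (T ω) := fun ω => RandomCircle.distortion_nonneg
  simp only [← inv_pow] at hlam_int hlam
  obtain ⟨hia, hia1⟩ := RandomCircle.integrable_of_sq ha0 hlam_int
  obtain ⟨κ, δ, θ, hκ0, hκ1, hδ, hκδ, hθ0, hθ1, hae⟩ := RandomCircle.ae_exists_remMass_le ha0 hb0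
    hia (RandomCircle.integrable_of_sq hb0 hdelta).1 (by linarith)
  refine ⟨θ, hθ0, hθ1, fun α hα0 hα1 => ?_⟩
  -- The rate `θ`, the exceptional null set and `C` were all obtained before `α` was introduced.
  filter_upwards [hae] with ω ⟨C, hC0, hC⟩
  have hd := RandomCircle.hasHolderDecay_of_remMass_le hT hκ0 hκ1 hδ hκδ hθ0 hα0 hα1 hC
  -- The factor 6 is the one needed for correlations; the `L¹` bound needs only 2.
  refine ⟨6 * (2 + 4 * C), by positivity, fun n ψ₁ ψ₂ h₁ h₂ => ?_, fun n ψ f g hψ hf hg =>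
    hd.correlation_le hT hα0 n hψ hf hg⟩
  refine (hd.eLpNorm_le hT hα0 n h₁ h₂).trans (ENNReal.ofReal_le_ofReal ?_)
  have := (RandomCircle.holderNorm_nonneg (α := α) ψ₁).trans
    (le_max_left _ (RandomCircle.holderNorm α ψ₂))
  gcongr
  norm_num
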